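/- Setting. Fix packet lengths $0<\ell_{\min}<\ell_{\max}$ and put $\rho=\ell_{\max}/\ell_{\min}$, $\bar\gamma=\lfloor\rho\rfloor$. Packets arrive at a sender according to a Poisson process of rate $\lambda>0$; independently, each packet is short (length $\ell_{\min}$) with probability $p\in(0,1)$ and long (length $\ell_{\max}$) with probability $1-p$. The sender transmits one packet at a time over a link of unit rate. An adversary causes instantaneous error events on the link; a packet whose transmission has an error event strictly inside its time interval is lost, the sender is notified at the instant of the error, and the packet has to be retransmitted in full. An adversarial error function $E$ maps each arrival pattern $A$ to a set $E(A)$ of error times such that the errors up to time $t$ depend (measurably) only on the arrivals (times and lengths) up to time $t$, there are almost surely only finitely many errors in each bounded time interval, and almost surely $L_{\mathrm{OPT}}(A,E,t)\to\infty$ as $t\to\infty$. Here $L_{\mathrm{OPT}}(A,E,t)$ is the largest total length of packets that an offline schedule, knowing all arrivals and errors, can transmit successfully by time $t$, and $L_{\mathrm{Alg}}(A,E,t)$ is the total length of the packets that the online algorithm $\mathrm{Alg}$ has transmitted successfully by time $t$. The relative throughput of $\mathrm{Alg}$ is $$T_{\mathrm{Alg}}=\inf_{E}\ \liminf_{t\to\infty}\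 \mathbb E_A\!\left[\frac{L_{\mathrm{Alg}}(A,E,t)}{L_{\mathrm{OPT}}(A,E,t)}\right],$$ where the ratio is $1$ if both lengths are $0$. Algorithms. All of them transmit whenever a packet is pending and interrupt a transmission only at an error. SL always chooses a short packet if one is pending, and a long one otherwise; LL always chooses a long packet if one is pending, and a short one otherwise. SL-Preamble checks, at the beginning and at each error event, whether at least $\bar\gamma$ short packets are pending; if so, it first schedules $\bar\gamma$ short packets and then follows LL until the next error, and if not, it follows LL until the next error. CSL-Preamble runs SL if $\lambda p\,\ell_{\min}>\bar\gamma/(2\rho)$, and SL-Preamble otherwise. Theorem. The relative throughput of CSL-Preamble is at least $\dfrac{\bar\gamma}{\rho+\bar\gamma}$ if $\lambda p\,\ell_{\min}\le\dfrac{\bar\gamma}{2\rho}$, and at least $\min\left\{\lambda p\,\ell_{\min},\dfrac{\bar\gamma}{\rho}\right\}$ otherwise. -/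

import Mathlib

open MeasureTheory ProbabilityTheory Filter Set
open scoped ENNReal Topology

namespace PacketScheduling

/-! ### Arrival patterns -/

/-- An arrival pattern with two packet lengths. Packet number `n` (in the order of arrival) is
described by `(A n).1`, the time between the arrival of packet `n - 1` (or time `0` if `n = 0`) and
its own arrival, and by `(A n).2`, which is `true` if the packet is short (length `lmin`) and
`false` if it is long (length `lmax`). -/
abbrev ArrivalPattern : Type := ℕ → ℝ × Bool

/-- The arrival time of packet `n`. -/
def arrivalTime (A : ArrivalPattern) (n : ℕ) : ℝ := ∑ i ∈ Finset.range (n + 1), (A i).1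

/-- The length of a short (`true`) or a long (`false`) packet. -/
def packetLength (lmin lmax : ℝ) (short : Bool) : ℝ := if short then lmin else lmax

/-- The number of packets of the given kind that have arrived by time `t` (inclusive). -/
noncomputable def arrived (A : ArrivalPattern) (short : Bool) (t : ℝ) : ℕ :=
  {n : ℕ | (A n).2 = short ∧ arrivalTime A n ≤ t}.ncard

/-- The law of the kind of a packet: short with probability `p`, long with probability `1 - p`. -/
noncomputable def kindLaw (p : ℝ) : Measure Bool :=
  ENNReal.ofReal p • Measure.dirac true + ENNReal.ofReal (1 - p) • Measure.dirac false

/-- The law of the arrival pattern: packets arrive according to a Poisson process of rate `lam`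
(independent exponential inter-arrival times), and, independently of this and of each other, each
packet is short with probability `p` and long with probability `1 - p`. -/
noncomputable def arrivalLaw (lam p : ℝ) : Measure ArrivalPattern :=
  Measure.infinitePi fun _ : ℕ => (expMeasure lam).prod (kindLaw p)

theorem isProbabilityMeasure_kindLaw {p : ℝ} (h0 : 0 < p) (h1 : p < 1) :
    IsProbabilityMeasure (kindLaw p) := by
  refine ⟨?_⟩
  rw [kindLaw, Measure.add_apply, Measure.smul_apply, Measure.smul_apply]
  simp only [measure_univ, smul_eq_mul, mul_one]
  rw [← ENNReal.ofReal_add h0.le (by linarith)]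
  simp

theorem isProbabilityMeasure_arrivalLaw {lam p : ℝ} (hlam : 0 < lam) (h0 : 0 < p) (h1 : p < 1) :
    IsProbabilityMeasure (arrivalLaw lam p) := by
  have := isProbabilityMeasure_kindLaw h0 h1
  have := isProbabilityMeasure_expMeasure hlam
  unfold arrivalLaw
  infer_instance

/-- The history of the arrivals up to time `t`: the σ-algebra generated by the arrival times that
are at most `t`, together with the kinds of the packets arriving at these times. -/
@[reducible] def history (t : ℝ) : MeasurableSpace ArrivalPattern :=
  MeasurableSpace.generateFrom
    {S | ∃ (n : ℕ) (s : ℝ) (b : Bool), s ≤ t ∧ S = {A | arrivalTime A n ≤ s ∧ (A n).2 = b}}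

/-! ### Offline schedules -/

/-- `IsSchedule lmin lmax A E σ` says that `σ` is a feasible offline schedule for the arrival
pattern `A` and the set `E` of error times. A schedule is given by its successful transmissions:
`σ n = some s` if packet `n` is successfully transmitted during the time interval from `s` to
`s + ℓ`, where `ℓ` is its length. (Unsuccessful transmissions do not count and need no record.)
A transmission starts no earlier than the arrival of the packet, no error event occurs strictly
inside its time interval, and different transmissions do not overlap. -/
def IsSchedule (lmin lmax : ℝ) (A : ArrivalPattern) (E : Set ℝ) (σ : ℕ → Option ℝ) : Prop :=
  (∀ n s, σ n = some s → 0 ≤ s ∧ arrivalTime A n ≤ s ∧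
    ∀ e ∈ E, ¬ (s < e ∧ e < s + packetLength lmin lmax (A n).2)) ∧
  ∀ n m s s', n ≠ m → σ n = some s → σ m = some s' →
    s + packetLength lmin lmax (A n).2 ≤ s' ∨ s' + packetLength lmin lmax (A m).2 ≤ s

open Classical in
/-- The total length of the packets whose transmission is completed by time `t` in `σ`. -/
noncomputable def scheduleLength (lmin lmax : ℝ) (A : ArrivalPattern) (σ : ℕ → Option ℝ) (t : ℝ) :
    ℝ≥0∞ :=
  ∑' n : ℕ, if ∃ s, σ n = some s ∧ s + packetLength lmin lmax (A n).2 ≤ t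
    then ENNReal.ofReal (packetLength lmin lmax (A n).2) else 0

/-- `L_OPT(A, E, t)`: the largest total length that an offline schedule, knowing all arrivals and
all errors, can transmit successfully by time `t`. -/
noncomputable def optLength (lmin lmax : ℝ) (A : ArrivalPattern) (E : Set ℝ) (t : ℝ) : ℝ≥0∞ :=
  ⨆ (σ : ℕ → Option ℝ) (_ : IsSchedule lmin lmax A E σ), scheduleLength lmin lmax A σ t

/-! ### Online algorithms and their executions -/

/-- A deterministic online scheduling algorithm with instantaneous feedback for packets of two
lengths. Its memory is a natural number. Its decisions are based on its memory and on the numbers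
of pending short and long packets (in this order); packets of equal length are transmitted in the
order of their arrival. -/
structure OnlineAlg where
  /-- The memory before the execution. -/
  init : ℕ
  /-- The update of the memory at the beginning of the execution and whenever the sender is
  notified of a link error; the arguments are the memory and the numbers of pending packets. -/
  restart : ℕ → ℕ → ℕ → ℕ
  /-- The update of the memory after a successful transmission. -/
  next : ℕ → ℕ
  /-- The kind of packet to be transmitted now (`none` for staying idle until the next event). -/
  pick : ℕ → ℕ → ℕ → Option Bool
  pick_short : ∀ m s l, pick m s l = some true → 0 < s
  pick_long : ∀ m s l, pick m s l = some false → 0 < l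

/-- The situation at a decision time: the current time, the memory of the algorithm, and the
numbers of short and long packets that have been transmitted successfully so far. -/
structure Config where
  time : ℝ
  mem : ℕ
  sentShort : ℕ
  sentLong : ℕ

/-- The number of pending short packets. -/
noncomputable def Config.pendingShort (A : ArrivalPattern) (c : Config) : ℕ :=
  arrived A true c.time - c.sentShort

/-- The number of pending long packets. -/
noncomputable def Config.pendingLong (A : ArrivalPattern) (c : Config) : ℕ :=
  arrived A false c.time - c.sentLong

/-- The update of the memory caused by the notification of an error. -/
noncomputable def Config.notify (alg : OnlineAlg) (A : ArrivalPattern) (c : Config) : Config :=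
  { c with mem := alg.restart c.mem (c.pendingShort A) (c.pendingLong A) }

open Classical in
/-- The update of the memory, if there is an error event at the current time. -/
noncomputable def Config.notifyIf (alg : OnlineAlg) (A : ArrivalPattern) (E : Set ℝ) (c : Config) :
    Config :=
  if c.time ∈ E then c.notify alg A else c

/-- The configuration after the successful transmission of a packet of kind `short`. -/
noncomputable def Config.deliver (lmin lmax : ℝ) (alg : OnlineAlg) (c : Config) (short : Bool) :
    Config where
  time := c.time + packetLength lmin lmax short
  mem := alg.next c.mem
  sentShort := if short then c.sentShort + 1 else c.sentShort
  sentLong := if short then c.sentLong else c.sentLong + 1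

open Classical in
/-- One step of the execution.
* If the algorithm stays idle, the next decision is made at the next event (an arrival or an
  error); if there is none, nothing happens any more.
* If it transmits a packet and an error occurs strictly inside the time interval of the
  transmission, then the transmission is stopped at the first such error, which is notified at once.
* Otherwise the packet is delivered at the end of the transmission.
In each case an error event at the new time is notified to the algorithm. -/
noncomputable def Config.step (lmin lmax : ℝ) (alg : OnlineAlg) (A : ArrivalPattern) (E : Set ℝ)
    (c : Config) : Config :=
  match alg.pick c.mem (c.pendingShort A) (c.pendingLong A) with
  | none =>
    if {u : ℝ | c.time < u ∧ (u ∈ range (arrivalTime A) ∨ u ∈ E)}.Nonempty then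
      Config.notifyIf alg A E
        { c with time := sInf {u : ℝ | c.time < u ∧ (u ∈ range (arrivalTime A) ∨ u ∈ E)} }
    else c
  | some short =>
    if ∃ e ∈ E, c.time < e ∧ e < c.time + packetLength lmin lmax short then
      Config.notifyIf alg A E { c with time := sInf {e : ℝ | e ∈ E ∧ c.time < e} }
    else
      Config.notifyIf alg A E (c.deliver lmin lmax alg short)

/-- The execution of an online algorithm: the configurations at its successive decision times. -/
noncomputable def execution (lmin lmax : ℝ) (alg : OnlineAlg) (A : ArrivalPattern) (E : Set ℝ) :
    ℕ → Config
  | 0 => Config.notify alg A { time := 0, mem := alg.init, sentShort := 0, sentLong := 0 }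
  | k + 1 => (execution lmin lmax alg A E k).step lmin lmax alg A E

/-- `L_Alg(A, E, t)`: the total length of the packets that the algorithm has transmitted
successfully by time `t`. -/
noncomputable def algLength (lmin lmax : ℝ) (alg : OnlineAlg) (A : ArrivalPattern) (E : Set ℝ)
    (t : ℝ) : ℝ≥0∞ :=
  ⨆ (k : ℕ) (_ : (execution lmin lmax alg A E k).time ≤ t),
    ENNReal.ofReal ((execution lmin lmax alg A E k).sentShort * lmin +
      (execution lmin lmax alg A E k).sentLong * lmax)

/-! ### The algorithms -/

/-- Shortest Length: short packets have priority. -/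
def pickSL (s l : ℕ) : Option Bool :=
  if 0 < s then some true else if 0 < l then some false else none

/-- Longest Length: long packets have priority. -/
def pickLL (s l : ℕ) : Option Bool :=
  if 0 < l then some false else if 0 < s then some true else none

/-- The algorithm SL. -/
def algSL : OnlineAlg where
  init := 0
  restart := fun _ _ _ => 0
  next := fun _ => 0
  pick := fun _ s l => pickSL s l
  pick_short := by intro m s l; unfold pickSL; split_ifs <;> simp_all
  pick_long := by intro m s l; unfold pickSL; split_ifs <;> simp_all

/-- The algorithm SL-Preamble with preambles of `g` short packets. Its memory is the number of
short packets of the current preamble that are still to be transmitted. At the beginning and at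
each error it schedules a preamble if at least `g` short packets are pending; after the preamble,
or without one, it follows the LL policy until the next error. -/
def algSLPreamble (g : ℕ) : OnlineAlg where
  init := 0
  restart := fun _ s _ => if g ≤ s then g else 0
  next := fun m => m - 1
  pick := fun m s l => if 0 < m ∧ 0 < s then some true else pickLL s l
  pick_short := by intro m s l; unfold pickLL; split_ifs <;> simp_all
  pick_long := by intro m s l; unfold pickLL; split_ifs <;> simp_all

/-- The ratio `ρ` of the two packet lengths. -/
noncomputable def rho (lmin lmax : ℝ) : ℝ := lmax / lmin

/-- `γ̄ = ⌊ρ⌋`. -/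
noncomputable def gammaBar (lmin lmax : ℝ) : ℕ := ⌊rho lmin lmax⌋₊

open Classical in
/-- The algorithm CSL-Preamble: it runs SL if `λ p ℓmin > γ̄ / (2ρ)`, and SL-Preamble otherwise. -/
noncomputable def algCSLPreamble (lmin lmax lam p : ℝ) : OnlineAlg :=
  if lam * p * lmin > gammaBar lmin lmax / (2 * rho lmin lmax) then algSL
  else algSLPreamble (gammaBar lmin lmax)

/-! ### Relative throughput under stochastic arrivals -/

/-- An adversarial error function for stochastic arrivals: it maps each arrival pattern `A` to the
set `E A` of the times of the error events.
* The decisions of the adversary are based on the past only: whether an error occurs in a time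
  interval `[a, b]` is determined (measurably) by the arrivals up to time `b`.
* Almost surely, there are finitely many errors in each bounded time interval.
* Almost surely, `L_OPT` is unbounded (non-trivial communication). -/
structure IsErrorFunction (lmin lmax lam p : ℝ) (E : ArrivalPattern → Set ℝ) : Prop where
  adapted : ∀ a b : ℝ, 0 ≤ a → a ≤ b →
    MeasurableSet[history b] {A : ArrivalPattern | (E A ∩ Icc a b).Nonempty}
  locallyFinite : ∀ᵐ A ∂(arrivalLaw lam p), ∀ t : ℝ, (E A ∩ Icc 0 t).Finite
  nontrivial : ∀ᵐ A ∂(arrivalLaw lam p),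
    Tendsto (fun t : ℝ => optLength lmin lmax A (E A) t) atTop (𝓝 ∞)

open Classical in
/-- The relative throughput by time `t`: the ratio `L_Alg / L_OPT`, which is `1` if both are `0`. -/
noncomputable def throughputAt (lmin lmax : ℝ) (alg : OnlineAlg) (A : ArrivalPattern) (E : Set ℝ)
    (t : ℝ) : ℝ≥0∞ :=
  if algLength lmin lmax alg A E t = 0 ∧ optLength lmin lmax A E t = 0 then 1
  else algLength lmin lmax alg A E t / optLength lmin lmax A E t

/-- The relative throughput under stochastic arrivals: the infimum over all adversarial error
functions of the long-run expected relative throughput by time `t`. The limit for `t → ∞` need not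
exist, hence the lower limit. -/
noncomputable def relativeThroughput (lmin lmax lam p : ℝ) (alg : OnlineAlg) : ℝ≥0∞ :=
  ⨅ (E : ArrivalPattern → Set ℝ) (_ : IsErrorFunction lmin lmax lam p E),
    liminf (fun t : ℝ => ∫⁻ A, throughputAt lmin lmax alg A (E A) t ∂(arrivalLaw lam p)) atTop

end PacketScheduling

/-! The core is deterministic. For locally finite arrivals and errors, every offline schedule
satisfies `V ≤ κ * sent + B`, where `V` is its completed length, `sent` is the delivered length of
the algorithm, and `B` does not depend on the errors. For SL-Preamble κ = 1 + ρ/γ̄. For SL κ = 1/c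
for any positive c below λpℓmin and γ̄/ρ, as soon as the short packets arriving by time t have total
length at least ct - D.

Between errors a busy algorithm works at full rate, so it falls behind only through the transmission
that an error destroys. No successful offline transmission straddles an error, so after an error the
two can be compared packet by packet. SL: if j short packets were delivered since the error and the
next one is running, an offline schedule has completed x short and y long packets with x + yγ̄ ≤ j,
hence at most ρ/γ̄ times as much. If SL picks a long packet instead, all short packets that have
arrived are delivered, while the offline schedule has completed at most t by time t. SL-Preamble:
during a preamble nothing is lost, and later a loss below ℓmax is charged to the γ̄ℓmin of the
preamble. If there is no preamble, fewer than γ̄ short packets are pending, so almost all short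
packets are delivered; the long packets of the offline schedule are at most ρ/γ̄ times the delivered
length plus a constant, by a separate comparison.

The additive losses must not accumulate over infinitely many errors; `IsPotential.invariant` ensures
this, and `isPotential_algSL`, `isPotential_preamble_long` and `isPotential_preamble` instantiate
it.

For the expectation, `inv_le_liminf_throughput` uses that `L_OPT → ∞` makes `B` negligible. For SL,
`B` depends on how soon the law of large numbers takes hold; it is uniform on events that increase
to full measure. -/

namespace PacketScheduling

section

/-! ### Executions on regular inputs -/

/-- Finitely many arrivals and finitely many errors in each bounded time interval. -/
structure IsRegular (A : ArrivalPattern) (E : Set ℝ) : Prop where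
  arrivals : Tendsto (arrivalTime A) atTop atTop
  errors : ∀ t : ℝ, (E ∩ Icc 0 t).Finite

theorem packetLength_pos {lmin lmax : ℝ} (h0 : 0 < lmin) (h1 : lmin < lmax) (b : Bool) :
    0 < packetLength lmin lmax b := by
  cases b <;> simp [packetLength] <;> linarith

theorem packetLength_le {lmin lmax : ℝ} (h1 : lmin < lmax) (b : Bool) :
    packetLength lmin lmax b ≤ lmax := by
  cases b <;> simp [packetLength]; linarith

theorem finite_arrivals {A : ArrivalPattern} (h : Tendsto (arrivalTime A) atTop atTop) (t : ℝ) :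
    {n : ℕ | arrivalTime A n ≤ t}.Finite := by
  have := h.eventually_gt_atTop t
  rw [← Nat.cofinite_eq_atTop, Filter.eventually_cofinite] at this
  simpa using this

theorem finite_arrivals_kind {A : ArrivalPattern} (h : Tendsto (arrivalTime A) atTop atTop)
    (b : Bool) (t : ℝ) : {n : ℕ | (A n).2 = b ∧ arrivalTime A n ≤ t}.Finite :=
  (finite_arrivals h t).subset fun _ hn => hn.2

theorem arrived_mono {A : ArrivalPattern} (h : Tendsto (arrivalTime A) atTop atTop) (b : Bool) :
    Monotone (arrived A b) := fun _ _ hst =>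
  ncard_le_ncard (fun _ hn => ⟨hn.1, hn.2.trans hst⟩) (finite_arrivals_kind h b _)

theorem isLeast_sInf_of_locally_finite {U : Set ℝ} (hne : U.Nonempty)
    (hfin : ∀ t, (U ∩ Iic t).Finite) : IsLeast U (sInf U) := by
  obtain ⟨u, hu⟩ := hne
  obtain ⟨m, hm, hmin⟩ := (hfin u).exists_minimalFor id _ ⟨u, hu, le_refl u⟩
  have hleast : IsLeast U m := by
    refine ⟨hm.1, fun v hv => ?_⟩
    by_contra! hlt
    exact absurd (hmin (show v ∈ U ∩ Iic u from ⟨hv, hlt.le.trans hm.2⟩) hlt.le) (not_le.2 hlt)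
  exact ⟨hleast.csInf_mem, fun v hv => csInf_le ⟨m, hleast.2⟩ hv⟩

variable {lmin lmax : ℝ} {alg : OnlineAlg} {A : ArrivalPattern} {E : Set ℝ}

theorem finite_events (h : IsRegular A E) (t : ℝ) :
    (arrivalTime A '' {n | arrivalTime A n ≤ t} ∪ E ∩ Icc 0 t).Finite :=
  ((finite_arrivals h.arrivals t).image _).union (h.errors t)

/-- The total length of the packets transmitted so far. -/
noncomputable def Config.sent (lmin lmax : ℝ) (c : Config) : ℝ :=
  c.sentShort * lmin + c.sentLong * lmax

theorem Config.sent_nonneg (h0 : 0 < lmin) (h1 : lmin < lmax) (c : Config) :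
    0 ≤ c.sent lmin lmax := by
  have : 0 < lmax := h0.trans h1
  unfold Config.sent; positivity

theorem Config.sent_deliver (c : Config) (b : Bool) :
    (c.deliver lmin lmax alg b).sent lmin lmax = c.sent lmin lmax + packetLength lmin lmax b := by
  cases b <;> simp [Config.sent, Config.deliver, packetLength] <;> ring

@[simp] theorem Config.notifyIf_time (c : Config) : (c.notifyIf alg A E).time = c.time := by
  unfold Config.notifyIf Config.notify; split_ifs <;> rfl

@[simp] theorem Config.notifyIf_sentShort (c : Config) :
    (c.notifyIf alg A E).sentShort = c.sentShort := by
  unfold Config.notifyIf Config.notify; split_ifs <;> rfl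

@[simp] theorem Config.notifyIf_sentLong (c : Config) :
    (c.notifyIf alg A E).sentLong = c.sentLong := by
  unfold Config.notifyIf Config.notify; split_ifs <;> rfl

theorem Config.notifyIf_mem (c : Config) :
    (c.time ∈ E ∧ (c.notifyIf alg A E).mem =
      alg.restart c.mem (c.pendingShort A) (c.pendingLong A)) ∨
    (c.time ∉ E ∧ (c.notifyIf alg A E).mem = c.mem) := by
  unfold Config.notifyIf Config.notify; split_ifs with h <;> simp [h]

/-- The algorithm stays idle until the next event. -/
def Config.IdleStep (alg : OnlineAlg) (A : ArrivalPattern) (E : Set ℝ) (c c' : Config) : Prop :=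
  alg.pick c.mem (c.pendingShort A) (c.pendingLong A) = none ∧
    c.time < c'.time ∧ (c'.time ∈ range (arrivalTime A) ∨ c'.time ∈ E) ∧
    (∀ n, ¬ (c.time < arrivalTime A n ∧ arrivalTime A n < c'.time)) ∧
    c' = Config.notifyIf alg A E { c with time := c'.time }

/-- The transmission of a packet of kind `b` is stopped by an error. -/
def Config.InterruptStep (lmin lmax : ℝ) (alg : OnlineAlg) (A : ArrivalPattern) (E : Set ℝ)
    (c : Config) (b : Bool) (c' : Config) : Prop :=
  alg.pick c.mem (c.pendingShort A) (c.pendingLong A) = some b ∧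
    c.time < c'.time ∧ c'.time < c.time + packetLength lmin lmax b ∧ c'.time ∈ E ∧
    c' = Config.notifyIf alg A E { c with time := c'.time }

/-- A packet of kind `b` is delivered. -/
def Config.DeliverStep (lmin lmax : ℝ) (alg : OnlineAlg) (A : ArrivalPattern) (E : Set ℝ)
    (c : Config) (b : Bool) (c' : Config) : Prop :=
  alg.pick c.mem (c.pendingShort A) (c.pendingLong A) = some b ∧
    c' = Config.notifyIf alg A E (c.deliver lmin lmax alg b)

/-- Local finiteness makes the infima in `Config.step` attained, so the new time is a genuine
arrival or error. Nonnegative time matters because errors are only known to be finite in number on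
`[0, t]`; idling always ends because the arrival times are unbounded. -/
theorem Config.step_cases (h : IsRegular A E) (c : Config) (hc : 0 ≤ c.time) :
    c.IdleStep alg A E (c.step lmin lmax alg A E) ∨
    (∃ b, c.InterruptStep lmin lmax alg A E b (c.step lmin lmax alg A E)) ∨
    ∃ b, c.DeliverStep lmin lmax alg A E b (c.step lmin lmax alg A E) := by
  rcases hp : alg.pick c.mem (c.pendingShort A) (c.pendingLong A) with _ | b
  · left
    set U := {u : ℝ | c.time < u ∧ (u ∈ range (arrivalTime A) ∨ u ∈ E)} with hU
    have hne : U.Nonempty := by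
      obtain ⟨n, hn⟩ := (h.arrivals.eventually_gt_atTop c.time).exists
      exact ⟨_, hn, Or.inl ⟨n, rfl⟩⟩
    have hleast : IsLeast U (sInf U) := by
      refine isLeast_sInf_of_locally_finite hne fun t => (finite_events h t).subset ?_
      rintro u ⟨⟨hu, ⟨n, rfl⟩ | hu2⟩, hut⟩
      · exact Or.inl ⟨n, hut, rfl⟩
      · exact Or.inr ⟨hu2, hc.trans hu.le, hut⟩
    have hstep : c.step lmin lmax alg A E =
        Config.notifyIf alg A E { c with time := sInf U } := by
      unfold Config.step; rw [hp]; simp only; rw [if_pos hne]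
    have ht : (c.step lmin lmax alg A E).time = sInf U := by rw [hstep]; simp
    refine ⟨hp, ?_, ?_, ?_, ?_⟩
    · rw [ht]; exact hleast.1.1
    · rw [ht]; exact hleast.1.2
    · rw [ht]; rintro n ⟨h1, h2⟩
      exact absurd (hleast.2 ⟨h1, Or.inl ⟨n, rfl⟩⟩) (not_le.2 h2)
    · rw [ht]; exact hstep
  · right
    by_cases he : ∃ e ∈ E, c.time < e ∧ e < c.time + packetLength lmin lmax b
    · left
      set U := {e : ℝ | e ∈ E ∧ c.time < e} with hU
      have hstep : c.step lmin lmax alg A E =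
          Config.notifyIf alg A E { c with time := sInf U } := by
        unfold Config.step; rw [hp]; simp only; rw [if_pos he]
      obtain ⟨e, heE, he1, he2⟩ := he
      have hleast : IsLeast U (sInf U) := by
        refine isLeast_sInf_of_locally_finite ⟨e, heE, he1⟩ fun t => (h.errors t).subset ?_
        rintro u ⟨⟨hu, hu2⟩, hut⟩
        exact ⟨hu, hc.trans hu2.le, hut⟩
      have ht : (c.step lmin lmax alg A E).time = sInf U := by rw [hstep]; simp
      refine ⟨b, hp, ?_, ?_, ?_, ?_⟩
      · rw [ht]; exact hleast.1.2
      · rw [ht]; exact (hleast.2 ⟨heE, he1⟩).trans_lt he2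
      · rw [ht]; exact hleast.1.1
      · rw [ht]; exact hstep
    · right
      refine ⟨b, hp, ?_⟩
      unfold Config.step; rw [hp]; simp only; rw [if_neg he]

theorem IdleStep_sent {c c' : Config} (h : c.IdleStep alg A E c') :
    c'.sentShort = c.sentShort ∧ c'.sentLong = c.sentLong := by
  rw [h.2.2.2.2]; simp

theorem InterruptStep_sent {c c' : Config} {b : Bool}
    (h : c.InterruptStep lmin lmax alg A E b c') :
    c'.sentShort = c.sentShort ∧ c'.sentLong = c.sentLong := by
  rw [h.2.2.2.2]; simp

theorem DeliverStep_time {c c' : Config} {b : Bool}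
    (h : c.DeliverStep lmin lmax alg A E b c') :
    c'.time = c.time + packetLength lmin lmax b := by
  rw [h.2]; simp [Config.deliver]

theorem DeliverStep_sent {c c' : Config} {b : Bool}
    (h : c.DeliverStep lmin lmax alg A E b c') :
    c'.sent lmin lmax = c.sent lmin lmax + packetLength lmin lmax b := by
  rw [← Config.sent_deliver (alg := alg), h.2]; simp [Config.sent]

theorem time_lt_step (h0 : 0 < lmin) (h1 : lmin < lmax) (h : IsRegular A E) (c : Config)
    (hc : 0 ≤ c.time) : c.time < (c.step lmin lmax alg A E).time := by
  rcases Config.step_cases (lmin := lmin) (lmax := lmax) (alg := alg) h c hc with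
    hs | ⟨b, hs⟩ | ⟨b, hs⟩
  · exact hs.2.1
  · exact hs.2.1
  · rw [DeliverStep_time hs]; linarith [packetLength_pos h0 h1 b]

theorem execution_time_nonneg (h0 : 0 < lmin) (h1 : lmin < lmax) (h : IsRegular A E) (k : ℕ) :
    0 ≤ (execution lmin lmax alg A E k).time := by
  induction k with
  | zero => simp [execution, Config.notify]
  | succ k ih => exact ih.trans (time_lt_step h0 h1 h _ ih).le

theorem execution_time_lt_succ (h0 : 0 < lmin) (h1 : lmin < lmax) (h : IsRegular A E) (k : ℕ) :
    (execution lmin lmax alg A E k).time < (execution lmin lmax alg A E (k + 1)).time :=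
  time_lt_step h0 h1 h _ (execution_time_nonneg h0 h1 h k)

theorem sent_le_arrived (h0 : 0 < lmin) (h1 : lmin < lmax) (h : IsRegular A E) (k : ℕ) :
    (execution lmin lmax alg A E k).sentShort ≤
      arrived A true (execution lmin lmax alg A E k).time ∧
    (execution lmin lmax alg A E k).sentLong ≤
      arrived A false (execution lmin lmax alg A E k).time := by
  induction k with
  | zero => simp [execution, Config.notify]
  | succ k ih =>
    have hlt := execution_time_lt_succ (alg := alg) h0 h1 h k
    have hm := fun b => arrived_mono h.arrivals b hlt.le
    have hmt := hm true
    have hmf := hm false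
    rcases Config.step_cases (lmin := lmin) (lmax := lmax) (alg := alg) h _
      (execution_time_nonneg (alg := alg) h0 h1 h k) with hs | ⟨b, hs⟩ | ⟨b, hs⟩
    · have := IdleStep_sent hs
      simp only [execution] at *; omega
    · have := InterruptStep_sent hs
      simp only [execution] at *; omega
    · have e1 : (execution lmin lmax alg A E (k + 1)).sentShort = _ :=
        congrArg Config.sentShort hs.2
      have e2 : (execution lmin lmax alg A E (k + 1)).sentLong = _ :=
        congrArg Config.sentLong hs.2
      cases b with
      | true =>
        have := alg.pick_short _ _ _ hs.1
        simp only [Config.notifyIf_sentShort, Config.notifyIf_sentLong, Config.deliver,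
          Config.pendingShort, if_true] at e1 e2 this
        omega
      | false =>
        have := alg.pick_long _ _ _ hs.1
        simp only [Config.notifyIf_sentShort, Config.notifyIf_sentLong, Config.deliver,
          Config.pendingLong, Bool.false_eq_true, if_false] at e1 e2 this
        omega

/-- Executions are not Zeno: each step either delivers a packet or moves to a new arrival or error
time, and only finitely many of both are available up to time `t`. -/
theorem execution_time_unbounded (h0 : 0 < lmin) (h1 : lmin < lmax) (h : IsRegular A E) (t : ℝ) :
    ∃ k, t < (execution lmin lmax alg A E k).time := by
  by_contra! hle
  set F := (finite_events h t).toFinset with hF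
  have key : ∀ k, k ≤ (execution lmin lmax alg A E k).sentShort +
      (execution lmin lmax alg A E k).sentLong +
      (F.filter (· ≤ (execution lmin lmax alg A E k).time)).card := by
    intro k
    induction k with
    | zero => simp
    | succ k ih =>
      have hnn := execution_time_nonneg (alg := alg) h0 h1 h (k + 1)
      have hlt := execution_time_lt_succ (alg := alg) h0 h1 h k
      have hsub : F.filter (· ≤ (execution lmin lmax alg A E k).time) ⊆
          F.filter (· ≤ (execution lmin lmax alg A E (k + 1)).time) := fun u hu => by
        rw [Finset.mem_filter] at hu ⊢; exact ⟨hu.1, hu.2.trans hlt.le⟩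
      have hev : (execution lmin lmax alg A E (k + 1)).time ∈ range (arrivalTime A) ∨
          (execution lmin lmax alg A E (k + 1)).time ∈ E →
          (F.filter (· ≤ (execution lmin lmax alg A E k).time)).card <
          (F.filter (· ≤ (execution lmin lmax alg A E (k + 1)).time)).card := by
        intro hev
        refine Finset.card_lt_card ((Finset.ssubset_iff_of_subset hsub).2
          ⟨(execution lmin lmax alg A E (k + 1)).time, ?_, ?_⟩)
        · rw [Finset.mem_filter, hF, Set.Finite.mem_toFinset]
          refine ⟨?_, le_rfl⟩
          rcases hev with ⟨n, hn⟩ | hev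
          · exact Or.inl ⟨n, hn.trans_le (hle _), hn⟩
          · exact Or.inr ⟨hev, hnn, hle _⟩
        · rw [Finset.mem_filter]; intro hh; exact absurd hh.2 (not_le.2 hlt)
      rcases Config.step_cases (lmin := lmin) (lmax := lmax) (alg := alg) h _
        (execution_time_nonneg (alg := alg) h0 h1 h k) with hs | ⟨b, hs⟩ | ⟨b, hs⟩
      · have e1 := IdleStep_sent hs
        have e2 := hev hs.2.2.1
        simp only [execution] at *; omega
      · have e1 := InterruptStep_sent hs
        have e2 := hev (Or.inr hs.2.2.2.1)
        simp only [execution] at *; omega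
      · have e1 : (execution lmin lmax alg A E (k + 1)).sentShort = _ :=
          congrArg Config.sentShort hs.2
        have e2 : (execution lmin lmax alg A E (k + 1)).sentLong = _ :=
          congrArg Config.sentLong hs.2
        have e3 := Finset.card_le_card hsub
        simp only [Config.notifyIf_sentShort, Config.notifyIf_sentLong, Config.deliver] at e1 e2
        cases b <;> simp at e1 e2 <;> omega
  set N := arrived A true t + arrived A false t + F.card
  have hN := key (N + 1)
  have e1 := sent_le_arrived (alg := alg) h0 h1 h (N + 1)
  have e2 := arrived_mono h.arrivals true (hle (N + 1))
  have e3 := arrived_mono h.arrivals false (hle (N + 1))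
  have e4 := Finset.card_filter_le F (· ≤ (execution lmin lmax alg A E (N + 1)).time)
  omega

theorem exists_decision_interval (h0 : 0 < lmin) (h1 : lmin < lmax) (h : IsRegular A E) {t : ℝ}
    (ht : 0 ≤ t) : ∃ k, (execution lmin lmax alg A E k).time ≤ t ∧
      t < (execution lmin lmax alg A E (k + 1)).time := by
  classical
  have hex := execution_time_unbounded (alg := alg) h0 h1 h t
  have hspec := Nat.find_spec hex
  rcases hk : Nat.find hex with _ | k
  · rw [hk] at hspec
    simp [execution, Config.notify] at hspec
    linarith
  · rw [hk] at hspec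
    exact ⟨k, not_lt.1 (Nat.find_min hex (by omega)), hspec⟩

end

section

/-! ### Offline schedules -/

/-- The properties of the numbers `O b t` of packets of kind `b` that an offline schedule completes
by time `t`. -/
structure IsOfflineCount (lmin lmax : ℝ) (A : ArrivalPattern) (E : Set ℝ) (O : Bool → ℝ → ℕ) :
    Prop where
  mono : ∀ b, Monotone (O b)
  zero : ∀ b, O b 0 = 0
  gain_of_error : ∀ e t, (e ∈ E ∨ e = 0) → e ≤ t →
    (O true t - O true e : ℝ) * lmin + (O false t - O false e : ℝ) * lmax ≤ t - e
  gain : ∀ e t, e ≤ t →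
    (O true t - O true e : ℝ) * lmin + (O false t - O false e : ℝ) * lmax ≤ t - e + lmax
  le_arrived : ∀ b s t, s ≤ t → (∀ n, ¬ (s < arrivalTime A n ∧ arrivalTime A n < t)) →
    O b t ≤ arrived A b s

/-- The packets whose transmission is completed by time `t` in the schedule `σ`. -/
def completed (lmin lmax : ℝ) (A : ArrivalPattern) (σ : ℕ → Option ℝ) (t : ℝ) : Set ℕ :=
  {n | ∃ s, σ n = some s ∧ s + packetLength lmin lmax (A n).2 ≤ t}

/-- The number of packets of kind `b` whose transmission is completed by time `t`. -/
noncomputable def completedCount (lmin lmax : ℝ) (A : ArrivalPattern) (σ : ℕ → Option ℝ)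
    (b : Bool) (t : ℝ) : ℕ :=
  {n | (A n).2 = b ∧ n ∈ completed lmin lmax A σ t}.ncard

variable {lmin lmax : ℝ} {A : ArrivalPattern} {E : Set ℝ} {σ : ℕ → Option ℝ}

theorem sum_length_le {ι : Type*} (W : Finset ι) (s len : ι → ℝ) {e t : ℝ} (het : e ≤ t)
    (hlen : ∀ i ∈ W, 0 ≤ len i) (hs : ∀ i ∈ W, e ≤ s i) (ht : ∀ i ∈ W, s i + len i ≤ t)
    (hdis : ∀ i ∈ W, ∀ j ∈ W, i ≠ j → s i + len i ≤ s j ∨ s j + len j ≤ s i) :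
    ∑ i ∈ W, len i ≤ t - e := by
  have hd : (W : Set ι).PairwiseDisjoint fun i => Ioc (s i) (s i + len i) := by
    intro i hi j hj hij
    refine Set.disjoint_left.2 fun x hx hy => ?_
    rcases hdis i hi j hj hij with h | h
    · linarith [hx.2, hy.1]
    · linarith [hx.1, hy.2]
  have hvol : volume (⋃ i ∈ W, Ioc (s i) (s i + len i)) ≤ volume (Ioc e t) := by
    refine measure_mono (iUnion₂_subset fun i hi => Ioc_subset_Ioc (hs i hi) (ht i hi))
  rw [measure_biUnion_finset hd fun _ _ => measurableSet_Ioc, Real.volume_Ioc] at hvol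
  simp only [Real.volume_Ioc, add_sub_cancel_left] at hvol
  rw [← ENNReal.ofReal_sum_of_nonneg hlen] at hvol
  exact (ENNReal.ofReal_le_ofReal_iff (by linarith)).1 hvol

theorem completed_subset_arrived (h0 : 0 < lmin) (h1 : lmin < lmax)
    (hσ : IsSchedule lmin lmax A E σ) {s t : ℝ}
    (hst : ∀ n, ¬ (s < arrivalTime A n ∧ arrivalTime A n < t)) :
    completed lmin lmax A σ t ⊆ {n | arrivalTime A n ≤ s} := by
  rintro n ⟨u, hu, hut⟩
  have h2 := (hσ.1 n u hu).2.1
  have h3 := packetLength_pos h0 h1 (A n).2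
  by_contra! hlt
  exact hst n ⟨by simpa using hlt, by linarith⟩

theorem finite_completed (h0 : 0 < lmin) (h1 : lmin < lmax) (h : IsRegular A E)
    (hσ : IsSchedule lmin lmax A E σ) (t : ℝ) : (completed lmin lmax A σ t).Finite :=
  (finite_arrivals h.arrivals t).subset
    (completed_subset_arrived h0 h1 hσ fun _ hn => lt_asymm hn.1 hn.2)

theorem sum_completed (h0 : 0 < lmin) (h1 : lmin < lmax) (h : IsRegular A E)
    (hσ : IsSchedule lmin lmax A E σ) (t : ℝ) :
    ∑ n ∈ (finite_completed h0 h1 h hσ t).toFinset, packetLength lmin lmax (A n).2 =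
      completedCount lmin lmax A σ true t * lmin + completedCount lmin lmax A σ false t * lmax := by
  have hc : ∀ b, completedCount lmin lmax A σ b t =
      ((finite_completed h0 h1 h hσ t).toFinset.filter fun n => (A n).2 = b).card := by
    intro b
    rw [completedCount, ← ncard_coe_finset]
    congr 1
    ext n
    simp [and_comm]
  rw [hc, hc]
  simp only [packetLength]
  rw [Finset.sum_ite]
  simp

theorem scheduleLength_eq (h0 : 0 < lmin) (h1 : lmin < lmax) (h : IsRegular A E)
    (hσ : IsSchedule lmin lmax A E σ) (t : ℝ) :
    scheduleLength lmin lmax A σ t = ENNReal.ofReal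
      (completedCount lmin lmax A σ true t * lmin +
        completedCount lmin lmax A σ false t * lmax) := by
  rw [← sum_completed h0 h1 h hσ, scheduleLength,
    tsum_eq_sum (s := (finite_completed h0 h1 h hσ t).toFinset),
    ENNReal.ofReal_sum_of_nonneg fun n _ => (packetLength_pos h0 h1 _).le]
  · refine Finset.sum_congr rfl fun n hn => if_pos ?_
    simpa [completed] using hn
  · intro n hn
    refine if_neg ?_
    simpa [completed] using hn

/-- The packets completed in `(e, t]` occupy disjoint intervals inside `[e', t]`. The parameter `e'`
covers both uses: `e' = e` if nothing straddles `e`, and `e' = e - lmax` in general. -/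
theorem completed_gain (h0 : 0 < lmin) (h1 : lmin < lmax) (h : IsRegular A E)
    (hσ : IsSchedule lmin lmax A E σ) {e e' t : ℝ} (het : e ≤ t) (het' : e' ≤ t)
    (hstart : ∀ n s, σ n = some s → e < s + packetLength lmin lmax (A n).2 → e' ≤ s) :
    (completedCount lmin lmax A σ true t - completedCount lmin lmax A σ true e : ℝ) * lmin +
      (completedCount lmin lmax A σ false t - completedCount lmin lmax A σ false e : ℝ) * lmax ≤
      t - e' := by
  have hsub : (finite_completed h0 h1 h hσ e).toFinset ⊆
      (finite_completed h0 h1 h hσ t).toFinset := by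
    intro n hn
    simp only [Finite.mem_toFinset] at hn ⊢
    obtain ⟨s, hs, hse⟩ := hn
    exact ⟨s, hs, hse.trans het⟩
  have hsum := Finset.sum_sdiff (f := fun n => packetLength lmin lmax (A n).2) hsub
  rw [sum_completed h0 h1 h hσ, sum_completed h0 h1 h hσ] at hsum
  have hmem : ∀ n ∈ (finite_completed h0 h1 h hσ t).toFinset \
      (finite_completed h0 h1 h hσ e).toFinset, ∃ s, σ n = some s ∧
        s + packetLength lmin lmax (A n).2 ≤ t ∧ e < s + packetLength lmin lmax (A n).2 := by
    intro n hn
    simp only [Finset.mem_sdiff, Finite.mem_toFinset] at hn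
    obtain ⟨⟨s, hs, hst⟩, hne⟩ := hn
    refine ⟨s, hs, hst, ?_⟩
    by_contra! hle
    exact hne ⟨s, hs, hle⟩
  have hle := sum_length_le ((finite_completed h0 h1 h hσ t).toFinset \
      (finite_completed h0 h1 h hσ e).toFinset) (fun n => (σ n).getD 0)
      (fun n => packetLength lmin lmax (A n).2) het'
      (fun n _ => (packetLength_pos h0 h1 _).le)
      (fun n hn => by
        obtain ⟨s, hs, _, h3⟩ := hmem n hn
        simpa [hs] using hstart n s hs h3)
      (fun n hn => by
        obtain ⟨s, hs, h2, _⟩ := hmem n hn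
        simpa [hs] using h2)
      (fun n hn m hm hnm => by
        obtain ⟨s, hs, _⟩ := hmem n hn
        obtain ⟨s', hs', _⟩ := hmem m hm
        simpa [hs, hs'] using hσ.2 n m s s' hnm hs hs')
  linarith

/-- No successful transmission straddles an error or time `0`, while at another time at most one
packet does, which costs an extra `lmax`. Since lengths are positive, a packet completed by `t`
arrived strictly before `t`, hence by `s` if nothing arrives in between. -/
theorem isOfflineCount_completedCount (h0 : 0 < lmin) (h1 : lmin < lmax) (h : IsRegular A E)
    (hσ : IsSchedule lmin lmax A E σ) :
    IsOfflineCount lmin lmax A E (completedCount lmin lmax A σ) where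
  mono b s t hst := by
    refine ncard_le_ncard ?_ ((finite_completed h0 h1 h hσ t).subset fun n hn => hn.2)
    rintro n ⟨hn, u, hu, hus⟩
    exact ⟨hn, u, hu, hus.trans hst⟩
  zero b := by
    have : {n | (A n).2 = b ∧ n ∈ completed lmin lmax A σ 0} = ∅ := by
      refine eq_empty_of_forall_notMem ?_
      rintro n ⟨_, s, hs, hs0⟩
      linarith [(hσ.1 n s hs).1, packetLength_pos h0 h1 (A n).2]
    rw [completedCount, this, ncard_empty]
  gain_of_error e t he het := by
    refine completed_gain h0 h1 h hσ het het fun n s hs hlt => ?_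
    by_contra! hse
    rcases he with he | rfl
    · exact (hσ.1 n s hs).2.2 e he ⟨hse, hlt⟩
    · exact absurd (hσ.1 n s hs).1 (not_le.2 hse)
  gain e t het := by
    have := completed_gain h0 h1 h hσ (e' := e - lmax) het (by linarith) fun n s hs hlt => by
      linarith [packetLength_le h1 (A n).2]
    linarith
  le_arrived b s t hst hn := by
    refine ncard_le_ncard (fun n hm => ⟨hm.1, ?_⟩) (finite_arrivals_kind h.arrivals b s)
    exact completed_subset_arrived h0 h1 hσ hn hm.2

theorem optLength_le_of_forall_isOfflineCount (h0 : 0 < lmin) (h1 : lmin < lmax)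
    (h : IsRegular A E) {t : ℝ} {B : ℝ≥0∞}
    (hB : ∀ O, IsOfflineCount lmin lmax A E O →
      ENNReal.ofReal (O true t * lmin + O false t * lmax) ≤ B) :
    optLength lmin lmax A E t ≤ B := by
  refine iSup₂_le fun σ hσ => ?_
  rw [scheduleLength_eq h0 h1 h hσ]
  exact hB _ (isOfflineCount_completedCount h0 h1 h hσ)

end

section

/-! ### A potential argument -/

/-- `V` bounds the value of an offline schedule, `κ` is the competitive ratio, and `Q m d` says that
the algorithm may have memory `m` after having been busy for a time `d` since the last error. -/
structure IsPotential (lmin lmax : ℝ) (alg : OnlineAlg) (A : ArrivalPattern) (E : Set ℝ)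
    (V : ℝ → ℝ) (κ C : ℝ) (Q : ℕ → ℝ → Prop) : Prop where
  zero : V 0 = 0
  one_le : 1 ≤ κ
  nonneg : 0 ≤ C
  gain : ∀ e t, e ≤ t → V t - V e ≤ t - e + lmax
  gain_of_error : ∀ e t, (e ∈ E ∨ e = 0) → e ≤ t → V t - V e ≤ t - e
  idle : ∀ k, let c := execution lmin lmax alg A E k
    alg.pick c.mem (c.pendingShort A) (c.pendingLong A) = none →
      ∀ t, c.time ≤ t → (∀ n, ¬ (c.time < arrivalTime A n ∧ arrivalTime A n < t)) →
        V t ≤ κ * c.sent lmin lmax + C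
  pick : ∀ k b, let c := execution lmin lmax alg A E k
    alg.pick c.mem (c.pendingShort A) (c.pendingLong A) = some b →
      V c.time ≤ κ * c.sent lmin lmax + C ∨
      ∀ d, Q c.mem d → Q (alg.next c.mem) (d + packetLength lmin lmax b) ∧
        ∀ e t, (e ∈ E ∨ e = 0) → e ≤ t → t - e < d + packetLength lmin lmax b →
          V t - V e ≤ κ * d
  restart : ∀ k m, let c := execution lmin lmax alg A E k
    Q (alg.restart m (c.pendingShort A) (c.pendingLong A)) 0 ∨
      V c.time ≤ κ * c.sent lmin lmax + C

/-- The invariant of the executions: either a bound with a small constant held at some time since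
which the algorithm has been busy, or a bound with a large constant held at the last error, since
which the algorithm has been busy according to the pattern `Q`. -/
def PotentialInvariant (lmin lmax : ℝ) (E : Set ℝ) (V : ℝ → ℝ) (κ C : ℝ) (Q : ℕ → ℝ → Prop)
    (c : Config) : Prop :=
  (∃ e a, e ≤ c.time ∧ V e ≤ κ * a + C ∧ a + (c.time - e) ≤ c.sent lmin lmax) ∨
  ∃ e a, (e ∈ E ∨ e = 0) ∧ e ≤ c.time ∧ V e ≤ κ * a + (C + 2 * lmax) ∧
    c.sent lmin lmax = a + (c.time - e) ∧ Q c.mem (c.time - e)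

variable {lmin lmax : ℝ} {alg : OnlineAlg} {A : ArrivalPattern} {E : Set ℝ} {V : ℝ → ℝ} {κ C : ℝ}
  {Q : ℕ → ℝ → Prop}

/-- In the first case of the invariant one `lmax` pays for an offline packet straddling `e` and the
other for the time since `c.time`, which may be wasted. In the second case `hbusy` leaves the
constant unchanged. -/
theorem PotentialInvariant.le (h : IsPotential lmin lmax alg A E V κ C Q)
    {c : Config} (hc : PotentialInvariant lmin lmax E V κ C Q c) {t : ℝ} (ht : c.time ≤ t)
    (htl : t ≤ c.time + lmax)
    (hbusy : ∀ d, Q c.mem d → ∀ e, (e ∈ E ∨ e = 0) → e ≤ t → t - e = d + (t - c.time) →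
      V t - V e ≤ κ * d) :
    V t ≤ κ * c.sent lmin lmax + (C + 2 * lmax) := by
  have hκ := h.one_le
  rcases hc with ⟨e, a, he, hV, ha⟩ | ⟨e, a, hE, he, hV, ha, hQ⟩
  · have g := h.gain e t (he.trans ht)
    have : κ * (a + (c.time - e)) ≤ κ * c.sent lmin lmax := by gcongr
    nlinarith
  · have g := hbusy _ hQ e hE (he.trans ht) (by ring)
    rw [ha]; linarith

theorem potentialInvariant_of_le {c : Config} (h : V c.time ≤ κ * c.sent lmin lmax + C) :
    PotentialInvariant lmin lmax E V κ C Q c :=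
  Or.inl ⟨c.time, c.sent lmin lmax, le_rfl, h, by simp⟩

/-- The constant never exceeds `C + 2 * lmax`, because the extra `2 * lmax` is paid only at an error
that ends a phase of the first kind. From an error on, `pick` bounds the offline gain by `κ * d`
without additive loss, so later errors cost nothing. A phase of the first kind starts only when the
bound with constant `C` holds afresh. -/
theorem IsPotential.invariant (h0 : 0 < lmin) (h1 : lmin < lmax) (hr : IsRegular A E)
    (h : IsPotential lmin lmax alg A E V κ C Q) (k : ℕ) :
    PotentialInvariant lmin lmax E V κ C Q (execution lmin lmax alg A E k) := by
  have hmax : 0 < lmax := h0.trans h1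
  have hκ := h.one_le
  induction k with
  | zero =>
    refine potentialInvariant_of_le ?_
    simp [execution, Config.notify, Config.sent, h.zero, h.nonneg]
  | succ k ih =>
    have hnn := execution_time_nonneg (alg := alg) h0 h1 hr k
    have hlt := execution_time_lt_succ (alg := alg) h0 h1 hr k
    have hpick := h.pick k
    have hidle := h.idle k
    have hrestart := h.restart (k + 1)
    have hcases := Config.step_cases (lmin := lmin) (lmax := lmax) (alg := alg) hr _ hnn
    rw [← execution] at hcases
    set c := execution lmin lmax alg A E k with hc
    set c' := execution lmin lmax alg A E (k + 1) with hc'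
    -- At an error the comparison starts anew at the current time. The notification changes only the
    -- memory, so the pending numbers seen by `restart` are those of `c'`.
    have hnotify : ∀ d : Config, c' = Config.notifyIf alg A E d → c'.time ∈ E →
        V c'.time ≤ κ * c'.sent lmin lmax + (C + 2 * lmax) →
        PotentialInvariant lmin lmax E V κ C Q c' := by
      intro d hd hE hV
      have ht : c'.time = d.time := by rw [hd]; simp
      have hs : c'.sentShort = d.sentShort := by rw [hd]; simp
      have hl : c'.sentLong = d.sentLong := by rw [hd]; simp
      rcases Config.notifyIf_mem (alg := alg) (A := A) (E := E) d with ⟨_, hm⟩ | ⟨hne, _⟩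
      · rw [← hd] at hm
        have hps : d.pendingShort A = c'.pendingShort A := by
          simp [Config.pendingShort, ht, hs]
        have hpl : d.pendingLong A = c'.pendingLong A := by
          simp [Config.pendingLong, ht, hl]
        rw [hps, hpl] at hm
        rcases hrestart d.mem with hQ | hV'
        · refine Or.inr ⟨c'.time, c'.sent lmin lmax, Or.inl hE, le_rfl, hV, by simp, ?_⟩
          rw [hm, sub_self]; exact hQ
        · exact potentialInvariant_of_le hV'
      · exact absurd (ht ▸ hE) hne
    rcases hcases with hs | ⟨b, hs⟩ | ⟨b, hs⟩
    · refine potentialInvariant_of_le ?_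
      have e := IdleStep_sent hs
      have : c'.sent lmin lmax = c.sent lmin lmax := by simp [Config.sent, e]
      rw [this]
      exact hidle hs.1 _ hs.2.1.le hs.2.2.2.1
    · have e := InterruptStep_sent hs
      have esent : c'.sent lmin lmax = c.sent lmin lmax := by simp [Config.sent, e]
      refine hnotify _ hs.2.2.2.2 hs.2.2.2.1 ?_
      rw [esent]
      have hlen := packetLength_le h1 b
      have h3 := hs.2.2.1
      rcases hpick b hs.1 with hV | hQ
      · have := h.gain c.time c'.time hlt.le
        linarith
      · exact ih.le h hlt.le (by linarith) fun d hd e he het htd =>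
          (hQ d hd).2 e _ he het (by linarith)
    · have ht := DeliverStep_time hs
      have hse := DeliverStep_sent hs
      have hmem : c'.time ∉ E → c'.mem = alg.next c.mem := by
        intro hne
        rcases Config.notifyIf_mem (alg := alg) (A := A) (E := E) (c.deliver lmin lmax alg b) with
          ⟨hE, _⟩ | ⟨_, hm⟩
        · refine absurd ?_ hne
          rw [hs.2]; simpa using hE
        · rw [← hs.2] at hm; exact hm
      have hlen := packetLength_le h1 b
      have hlpos := packetLength_pos h0 h1 b
      -- The transmission succeeded, so its duration is also delivered length and is absorbed by `κ
      -- ≥ 1`.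
      have key : V c'.time ≤ κ * c'.sent lmin lmax + (C + 2 * lmax) := by
        rw [hse]
        rcases ih with ⟨e, a, he, hV, ha⟩ | ⟨e, a, hE, he, hV, ha, hQ⟩
        · have g := h.gain e c'.time (he.trans hlt.le)
          nlinarith
        · have g := h.gain_of_error e c'.time hE (he.trans hlt.le)
          nlinarith
      by_cases hE : c'.time ∈ E
      · exact hnotify _ hs.2 hE key
      · have lax : ∀ e a, e ≤ c.time → V e ≤ κ * a + C → a + (c.time - e) ≤ c.sent lmin lmax →
            PotentialInvariant lmin lmax E V κ C Q c' := fun e a he hV ha =>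
          Or.inl ⟨e, a, he.trans hlt.le, hV, by linarith⟩
        rcases ih with ⟨e, a, he, hV, ha⟩ | ⟨e, a, hE', he, hV, ha, hQ⟩
        · exact lax e a he hV ha
        · rcases hpick b hs.1 with hV' | hQ'
          · exact lax c.time (c.sent lmin lmax) le_rfl hV' (by simp)
          · refine Or.inr ⟨e, a, hE', he.trans hlt.le, hV, by linarith, ?_⟩
            rw [hmem hE, ht, add_sub_right_comm]
            exact (hQ' _ hQ).1

/-- This form lets one potential serve as input for another: SL-Preamble needs the bound for long
packets at its restarts. -/
theorem IsPotential.le_at_decision (h0 : 0 < lmin) (h1 : lmin < lmax) (hr : IsRegular A E)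
    (h : IsPotential lmin lmax alg A E V κ C Q) (k : ℕ) :
    V (execution lmin lmax alg A E k).time ≤
      κ * (execution lmin lmax alg A E k).sent lmin lmax + (C + 2 * lmax) := by
  have hκ := h.one_le
  have hmax : 0 < lmax := h0.trans h1
  refine (h.invariant h0 h1 hr k).le h le_rfl (by linarith) fun d _ e he het hd => ?_
  have := h.gain_of_error e _ he het
  nlinarith

theorem IsPotential.exists_le (h0 : 0 < lmin) (h1 : lmin < lmax) (hr : IsRegular A E)
    (h : IsPotential lmin lmax alg A E V κ C Q) {t : ℝ} (ht : 0 ≤ t) :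
    ∃ k, (execution lmin lmax alg A E k).time ≤ t ∧
      V t ≤ κ * (execution lmin lmax alg A E k).sent lmin lmax + (C + 2 * lmax) := by
  have hmax : 0 < lmax := h0.trans h1
  obtain ⟨k, hk, hk'⟩ := exists_decision_interval (alg := alg) h0 h1 hr ht
  refine ⟨k, hk, ?_⟩
  have hcases := Config.step_cases (lmin := lmin) (lmax := lmax) (alg := alg) hr _
    (execution_time_nonneg (alg := alg) h0 h1 hr k)
  rw [← execution] at hcases
  have busy : ∀ b, alg.pick (execution lmin lmax alg A E k).mem
      ((execution lmin lmax alg A E k).pendingShort A)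
      ((execution lmin lmax alg A E k).pendingLong A) = some b →
      t < (execution lmin lmax alg A E k).time + packetLength lmin lmax b →
      V t ≤ κ * (execution lmin lmax alg A E k).sent lmin lmax + (C + 2 * lmax) := by
    intro b hb htb
    have hlen := packetLength_le h1 b
    rcases h.pick k b hb with hV | hQ
    · have := h.gain _ _ hk
      linarith
    · exact (h.invariant h0 h1 hr k).le h hk (by linarith) fun d hd e he het htd =>
        (hQ d hd).2 e _ he het (by linarith)
  rcases hcases with hs | ⟨b, hs⟩ | ⟨b, hs⟩
  · have := h.idle k hs.1 t hk fun n hn => hs.2.2.2.1 n ⟨hn.1, hn.2.trans hk'⟩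
    linarith
  · exact busy b hs.1 (hk'.trans hs.2.2.1)
  · exact busy b hs.1 (DeliverStep_time hs ▸ hk')

end

section

variable {lmin lmax : ℝ} {alg : OnlineAlg} {A : ArrivalPattern} {E : Set ℝ} {O : Bool → ℝ → ℕ}

/-! ### The algorithms on regular inputs -/

/-- Every packet that an offline schedule can complete by `t` has arrived by `c.time`, and all those
are delivered. -/
theorem le_sent_of_idle (h0 : 0 < lmin) (h1 : lmin < lmax) (hO : IsOfflineCount lmin lmax A E O)
    {c : Config} (hs : c.pendingShort A = 0) (hl : c.pendingLong A = 0) {t : ℝ} (ht : c.time ≤ t)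
    (hn : ∀ n, ¬ (c.time < arrivalTime A n ∧ arrivalTime A n < t)) :
    O true t * lmin + O false t * lmax ≤ c.sent lmin lmax := by
  have hmax := h0.trans h1
  have e1 : O true t ≤ c.sentShort :=
    (hO.le_arrived true _ _ ht hn).trans (Nat.sub_eq_zero_iff_le.1 hs)
  have e2 : O false t ≤ c.sentLong :=
    (hO.le_arrived false _ _ ht hn).trans (Nat.sub_eq_zero_iff_le.1 hl)
  unfold Config.sent; gcongr

theorem long_le_sent (h0 : 0 < lmin) (h1 : lmin < lmax) (hO : IsOfflineCount lmin lmax A E O)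
    {c : Config} (hl : c.pendingLong A = 0) {t : ℝ} (ht : c.time ≤ t)
    (hn : ∀ n, ¬ (c.time < arrivalTime A n ∧ arrivalTime A n < t)) :
    O false t * lmax ≤ c.sent lmin lmax := by
  have hmax := h0.trans h1
  have e2 : O false t ≤ c.sentLong :=
    (hO.le_arrived false _ _ ht hn).trans (Nat.sub_eq_zero_iff_le.1 hl)
  have : (O false t : ℝ) * lmax ≤ c.sentLong * lmax := by gcongr
  have : 0 ≤ (c.sentShort : ℝ) * lmin := by positivity
  unfold Config.sent; linarith

theorem IsOfflineCount.exists_gain (hO : IsOfflineCount lmin lmax A E O) {e t : ℝ}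
    (he : e ∈ E ∨ e = 0) (het : e ≤ t) : ∃ x y : ℕ, O true t = O true e + x ∧
      O false t = O false e + y ∧ (x : ℝ) * lmin + y * lmax ≤ t - e := by
  obtain ⟨x, hx⟩ := Nat.exists_eq_add_of_le (hO.mono true het)
  obtain ⟨y, hy⟩ := Nat.exists_eq_add_of_le (hO.mono false het)
  refine ⟨x, y, hx, hy, ?_⟩
  have := hO.gain_of_error e t he het
  rw [hx, hy] at this
  push_cast at this
  linarith

theorem pickSL_eq_none {s l : ℕ} (h : pickSL s l = none) : s = 0 ∧ l = 0 := by
  unfold pickSL at h; split_ifs at h; omega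

theorem pickSL_eq_long {s l : ℕ} (h : pickSL s l = some false) : s = 0 := by
  unfold pickSL at h; split_ifs at h <;> simp_all

theorem pickLL_eq_none {s l : ℕ} (h : pickLL s l = none) : s = 0 ∧ l = 0 := by
  unfold pickLL at h; split_ifs at h; omega

theorem pickLL_eq_short {s l : ℕ} (h : pickLL s l = some true) : l = 0 := by
  unfold pickLL at h; split_ifs at h <;> simp_all

/-- `Q` records that only short packets were delivered since the last error. When SL turns to a long
packet, all arrived short ones are delivered, so `harr` and the trivial bound of the offline value
by elapsed time give the bound with constant `D / c`, whatever happened before. -/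
theorem isPotential_algSL (h0 : 0 < lmin) (h1 : lmin < lmax) (hr : IsRegular A E)
    (hO : IsOfflineCount lmin lmax A E O) {g : ℕ} (hg : g * lmin ≤ lmax) {c D : ℝ} (hc : 0 < c)
    (hcg : c * lmax ≤ g * lmin) (hD : 0 ≤ D)
    (harr : ∀ t, 0 ≤ t → c * t - D ≤ arrived A true t * lmin) :
    IsPotential lmin lmax algSL A E (fun t => O true t * lmin + O false t * lmax) (1 / c) (D / c)
      (fun _ d => ∃ j : ℕ, d = j * lmin) := by
  have hmax := h0.trans h1
  have hc1 : c ≤ 1 := by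
    have : c * lmax ≤ 1 * lmax := by linarith
    exact le_of_mul_le_mul_right this hmax
  have hone : 1 ≤ 1 / c := by rw [le_div_iff₀ hc]; linarith
  refine ⟨by simp [hO.zero], hone, by positivity, ?_, ?_, ?_, ?_, ?_⟩
  · intro e t het
    have := hO.gain e t het; linarith
  · intro e t he het
    have := hO.gain_of_error e t he het; linarith
  · intro k cfg hp t ht hn
    obtain ⟨hs, hl⟩ := pickSL_eq_none hp
    have := le_sent_of_idle h0 h1 hO hs hl ht hn
    have h2 := Config.sent_nonneg h0 h1 cfg
    have h3 : 0 ≤ D / c := by positivity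
    have h4 := mul_le_mul_of_nonneg_right hone h2
    linarith
  · intro k b cfg hp
    cases b with
    | false =>
      left
      have hs := pickSL_eq_long hp
      have hT := execution_time_nonneg (alg := algSL) h0 h1 hr k
      have hV := hO.gain_of_error 0 cfg.time (Or.inr rfl) hT
      simp only [hO.zero, CharP.cast_eq_zero, sub_zero] at hV
      have ha := harr cfg.time hT
      have e1 : arrived A true cfg.time ≤ cfg.sentShort := Nat.sub_eq_zero_iff_le.1 hs
      have e2 : (arrived A true cfg.time : ℝ) * lmin ≤ cfg.sentShort * lmin := by gcongr
      have e3 : 0 ≤ (cfg.sentLong : ℝ) * lmax := by positivity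
      have e4 : cfg.time ≤ 1 / c * cfg.sent lmin lmax + D / c := by
        rw [← sub_le_iff_le_add, one_div, inv_mul_eq_div, le_div_iff₀ hc]
        have : D / c * c = D := by field_simp
        unfold Config.sent
        nlinarith
      linarith
    | true =>
      right
      rintro d ⟨j, rfl⟩
      refine ⟨⟨j + 1, by simp [packetLength]; ring⟩, ?_⟩
      intro e t he het hlt
      obtain ⟨x, y, hx, hy, hxy⟩ := hO.exists_gain he het
      simp only [hx, hy, packetLength, if_true] at hlt ⊢
      -- Each long packet takes at least the time of `g` short ones, so integrality gives `x + y * g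
      -- ≤ j`.
      have h2 : ((x + y * g : ℕ) : ℝ) * lmin < ((j + 1 : ℕ) : ℝ) * lmin := by
        push_cast
        have : (y : ℝ) * (g * lmin) ≤ y * lmax := by gcongr
        linarith
      have h3 : x + y * g ≤ j := by
        have := lt_of_mul_lt_mul_right h2 h0.le
        have : x + y * g < j + 1 := by exact_mod_cast this
        omega
      have h4 : ((x : ℝ) + y * g) * lmin ≤ j * lmin := by
        have : ((x + y * g : ℕ) : ℝ) ≤ j := by exact_mod_cast h3
        push_cast at this
        gcongr
      rw [one_div, inv_mul_eq_div, le_div_iff₀ hc]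
      push_cast
      have h5 : (y : ℝ) * (c * lmax) ≤ y * (g * lmin) := by gcongr
      have h6 : c * (x * lmin) ≤ 1 * (x * lmin) := by gcongr
      linarith
  · intro k m cfg
    left
    exact ⟨0, by simp⟩

/-- A preamble never runs out of packets, since it is scheduled only when all of them are pending.
Thus the memory alone decides whether the algorithm is inside a preamble. -/
theorem preamble_mem_le (h0 : 0 < lmin) (h1 : lmin < lmax) (hr : IsRegular A E) (g k : ℕ) :
    (execution lmin lmax (algSLPreamble g) A E k).mem ≤
      (execution lmin lmax (algSLPreamble g) A E k).pendingShort A := by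
  have hrestart : ∀ m s l, (algSLPreamble g).restart m s l ≤ s := by
    intro m s l; simp only [algSLPreamble]; split_ifs <;> omega
  have hnotify : ∀ c : Config, c.mem ≤ c.pendingShort A →
      (c.notifyIf (algSLPreamble g) A E).mem ≤
        (c.notifyIf (algSLPreamble g) A E).pendingShort A := by
    intro c hc
    have : (c.notifyIf (algSLPreamble g) A E).pendingShort A = c.pendingShort A := by
      simp [Config.pendingShort]
    rw [this]
    rcases Config.notifyIf_mem (alg := algSLPreamble g) (A := A) (E := E) c with ⟨_, h⟩ | ⟨_, h⟩
    · rw [h]; exact hrestart _ _ _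
    · rw [h]; exact hc
  induction k with
  | zero =>
    simp only [execution, Config.notify]
    exact hrestart _ _ _
  | succ k ih =>
    have hnn := execution_time_nonneg (alg := algSLPreamble g) h0 h1 hr k
    have hlt := execution_time_lt_succ (alg := algSLPreamble g) h0 h1 hr k
    have hm := arrived_mono hr.arrivals true hlt.le
    have hcases := Config.step_cases (lmin := lmin) (lmax := lmax) (alg := algSLPreamble g) hr _ hnn
    rw [← execution] at hcases
    set c := execution lmin lmax (algSLPreamble g) A E k
    set c' := execution lmin lmax (algSLPreamble g) A E (k + 1)
    rcases hcases with hs | ⟨b, hs⟩ | ⟨b, hs⟩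
    · rw [hs.2.2.2.2]
      refine hnotify _ (ih.trans ?_)
      simp only [Config.pendingShort]; omega
    · rw [hs.2.2.2.2]
      refine hnotify _ (ih.trans ?_)
      simp only [Config.pendingShort]; omega
    · have ht := DeliverStep_time hs
      rw [hs.2]
      refine hnotify _ ?_
      rw [ht] at hm
      cases b <;>
        simp only [Config.pendingShort, Config.deliver, algSLPreamble, if_true,
          Bool.false_eq_true, if_false] at * <;> omega

theorem preamble_pick_none {g m s l : ℕ} (h : (algSLPreamble g).pick m s l = none) :
    s = 0 ∧ l = 0 := by
  simp only [algSLPreamble] at h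
  split_ifs at h
  exact pickLL_eq_none h

theorem preamble_pick_short {g m s l : ℕ} (hm : m ≤ s)
    (h : (algSLPreamble g).pick m s l = some true) : 0 < m ∨ m = 0 ∧ l = 0 := by
  simp only [algSLPreamble] at h
  split_ifs at h with h'
  · exact Or.inl h'.1
  · exact Or.inr ⟨by omega, pickLL_eq_short h⟩

theorem preamble_pick_long {g m s l : ℕ} (hm : m ≤ s)
    (h : (algSLPreamble g).pick m s l = some false) : m = 0 := by
  simp only [algSLPreamble] at h
  split_ifs at h with h'
  · simp at h
  · omega

/-- The alternatives of `Q` are: no preamble since the error, inside the preamble, after it. A short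
packet sent outside a preamble means that all long packets have been delivered. A preamble delays
the long packets by at most one long slot, and κ is chosen so that its length `g * lmin` pays for
one long packet. -/
theorem isPotential_preamble_long (h0 : 0 < lmin) (h1 : lmin < lmax) (hr : IsRegular A E)
    (hO : IsOfflineCount lmin lmax A E O) {g : ℕ} (hg0 : 0 < g) (hg : g * lmin ≤ lmax) :
    IsPotential lmin lmax (algSLPreamble g) A E (fun t => O false t * lmax)
      (lmax / (g * lmin)) 0
      (fun m d => (∃ i : ℕ, m = 0 ∧ d = i * lmax) ∨
        (0 < m ∧ ∃ j : ℕ, m + j = g ∧ d = j * lmin) ∨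
        ∃ i : ℕ, m = 0 ∧ d = g * lmin + i * lmax) := by
  have hmax := h0.trans h1
  have hgl : 0 < (g : ℝ) * lmin := by positivity
  have hone : 1 ≤ lmax / (g * lmin) := by rw [le_div_iff₀ hgl]; linarith
  -- Leaving the short packets out of the value can only decrease a gain.
  have hmono : ∀ e t, e ≤ t → (O true e : ℝ) * lmin ≤ O true t * lmin := by
    intro e t het
    have := hO.mono true het
    gcongr
  have hsent : ∀ c : Config,
      c.sent lmin lmax ≤ lmax / (g * lmin) * c.sent lmin lmax := fun c =>
    le_mul_of_one_le_left (Config.sent_nonneg h0 h1 c) hone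
  refine ⟨by simp [hO.zero], hone, le_rfl, ?_, ?_, ?_, ?_, ?_⟩
  · intro e t het
    have := hO.gain e t het
    have := hmono e t het; linarith
  · intro e t he het
    have := hO.gain_of_error e t he het
    have := hmono e t het; linarith
  · intro k cfg hp t ht hn
    obtain ⟨_, hl⟩ := preamble_pick_none hp
    have := long_le_sent h0 h1 hO hl ht hn
    have := hsent cfg
    linarith
  · intro k b cfg hp
    have hmem : cfg.mem ≤ cfg.pendingShort A := preamble_mem_le h0 h1 hr g k
    clear_value cfg
    cases b with
    | true =>
      rcases preamble_pick_short hmem hp with hm | ⟨_, hl⟩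
      · right
        intro d hd
        have hd' : ∃ j : ℕ, cfg.mem + j = g ∧ d = j * lmin := by
          rcases hd with ⟨i, hi, _⟩ | hd | ⟨i, hi, _⟩
          · exact absurd hi hm.ne'
          · exact hd.2
          · exact absurd hi hm.ne'
        obtain ⟨j, hj, rfl⟩ := hd'
        refine ⟨?_, ?_⟩
        · simp only [algSLPreamble, packetLength, if_true]
          rcases Nat.lt_or_ge 1 cfg.mem with hm1 | hm1
          · exact Or.inr (Or.inl ⟨by omega, j + 1, by omega, by push_cast; ring⟩)
          · have : g = j + 1 := by omega
            -- This was the last packet of the preamble, so the third alternative begins with no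
            -- long packet.
            exact Or.inr (Or.inr ⟨0, by omega, by rw [this]; push_cast; ring⟩)
        · intro e t he het hlt
          obtain ⟨x, y, hx, hy, hxy⟩ := hO.exists_gain he het
          simp only [hy, packetLength, if_true] at hlt ⊢
          have hjg : ((j : ℝ) + 1) * lmin ≤ g * lmin := by
            have : ((j + 1 : ℕ) : ℝ) ≤ g := by exact_mod_cast (by omega : j + 1 ≤ g)
            push_cast at this
            gcongr
          have hx0 : 0 ≤ (x : ℝ) * lmin := by positivity
          have hy0 : (y : ℝ) * lmax < 1 * lmax := by linarith
          have hy1 : y = 0 := by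
            have := lt_of_mul_lt_mul_right hy0 hmax.le
            have : y < 1 := by exact_mod_cast this
            omega
          rw [hy1]
          have : 0 ≤ lmax / (g * lmin) * (j * lmin) := by positivity
          simpa using this
      · left
        have := long_le_sent h0 h1 hO hl le_rfl fun n hn => lt_asymm hn.1 hn.2
        have := hsent cfg
        linarith
    | false =>
      right
      have hm := preamble_pick_long hmem hp
      intro d hd
      rcases hd with ⟨i, _, rfl⟩ | ⟨hm', _⟩ | ⟨i, _, rfl⟩
      · refine ⟨Or.inl ⟨i + 1, by simp only [algSLPreamble]; omega, ?_⟩, ?_⟩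
        · simp [packetLength]; ring
        · intro e t he het hlt
          obtain ⟨x, y, hx, hy, hxy⟩ := hO.exists_gain he het
          simp only [hy, packetLength, Bool.false_eq_true, if_false] at hlt ⊢
          have hx0 : 0 ≤ (x : ℝ) * lmin := by positivity
          have hy0 : (y : ℝ) * lmax < ((i + 1 : ℕ) : ℝ) * lmax := by push_cast; linarith
          have hy1 : y ≤ i := by
            have := lt_of_mul_lt_mul_right hy0 hmax.le
            have : y < i + 1 := by exact_mod_cast this
            omega
          have h2 : (y : ℝ) * lmax ≤ i * lmax := by gcongr
          have h3 := le_mul_of_one_le_left (show 0 ≤ (i : ℝ) * lmax by positivity) hone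
          push_cast; linarith
      · omega
      · refine ⟨Or.inr (Or.inr ⟨i + 1, by simp only [algSLPreamble]; omega, ?_⟩), ?_⟩
        · simp [packetLength]; ring
        · intro e t he het hlt
          obtain ⟨x, y, hx, hy, hxy⟩ := hO.exists_gain he het
          simp only [hy, packetLength, Bool.false_eq_true, if_false] at hlt ⊢
          have hx0 : 0 ≤ (x : ℝ) * lmin := by positivity
          -- The preamble, the `i` delivered long packets and the running one together last at most
          -- `(i + 2) * lmax`.
          have hy0 : (y : ℝ) * lmax < ((i + 2 : ℕ) : ℝ) * lmax := by push_cast; linarith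
          have hy1 : y ≤ i + 1 := by
            have := lt_of_mul_lt_mul_right hy0 hmax.le
            have : y < i + 2 := by exact_mod_cast this
            omega
          have h2 : (y : ℝ) * lmax ≤ ((i + 1 : ℕ) : ℝ) * lmax := by gcongr
          have h3 := le_mul_of_one_le_left (show 0 ≤ (i : ℝ) * lmax by positivity) hone
          have h4 : lmax / (g * lmin) * (g * lmin) = lmax := by field_simp
          push_cast at h2 ⊢; linarith
  · intro k m cfg
    left
    simp only [algSLPreamble]
    split_ifs
    · exact Or.inr (Or.inl ⟨hg0, 0, by simp⟩)
    · exact Or.inl ⟨0, by simp⟩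

/-- `Q` has no alternative for a restart without a preamble: there the bound with constant `C`
already holds, so the invariant falls back to its first case. -/
theorem isPotential_preamble (h0 : 0 < lmin) (h1 : lmin < lmax) (hr : IsRegular A E)
    (hO : IsOfflineCount lmin lmax A E O) {g : ℕ} (hg0 : 0 < g) (hg : g * lmin ≤ lmax) :
    IsPotential lmin lmax (algSLPreamble g) A E (fun t => O true t * lmin + O false t * lmax)
      (1 + lmax / (g * lmin)) (g * lmin + 2 * lmax)
      (fun m d => (0 < m ∧ ∃ j : ℕ, m + j = g ∧ d = j * lmin) ∨ (m = 0 ∧ g * lmin ≤ d)) := by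
  have hmax := h0.trans h1
  have hgl : 0 < (g : ℝ) * lmin := by positivity
  have hpos : 0 ≤ lmax / (g * lmin) := by positivity
  refine ⟨by simp [hO.zero], by linarith, by positivity, ?_, ?_, ?_, ?_, ?_⟩
  · intro e t het
    have := hO.gain e t het; linarith
  · intro e t he het
    have := hO.gain_of_error e t he het; linarith
  · intro k cfg hp t ht hn
    obtain ⟨hs, hl⟩ := preamble_pick_none hp
    have := le_sent_of_idle h0 h1 hO hs hl ht hn
    have := mul_nonneg hpos (Config.sent_nonneg h0 h1 cfg)
    linarith
  · intro k b cfg hp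
    have hmem : cfg.mem ≤ cfg.pendingShort A := preamble_mem_le h0 h1 hr g k
    clear_value cfg
    right
    -- After the preamble the offline gain exceeds `d` by less than `lmax`, and `lmax ≤ lmax / (g *
    -- lmin) * d` because `d ≥ g * lmin`.
    have hafter : cfg.mem = 0 → ∀ d, ((0 < cfg.mem ∧ ∃ j : ℕ, cfg.mem + j = g ∧ d = j * lmin) ∨
        (cfg.mem = 0 ∧ g * lmin ≤ d)) →
        ((0 < (algSLPreamble g).next cfg.mem ∧ ∃ j : ℕ, (algSLPreamble g).next cfg.mem + j = g ∧
            d + packetLength lmin lmax b = j * lmin) ∨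
          ((algSLPreamble g).next cfg.mem = 0 ∧ g * lmin ≤ d + packetLength lmin lmax b)) ∧
        ∀ e t, (e ∈ E ∨ e = 0) → e ≤ t → t - e < d + packetLength lmin lmax b →
          (O true t * lmin + O false t * lmax) - (O true e * lmin + O false e * lmax) ≤
            (1 + lmax / (g * lmin)) * d := by
      intro hm d hd
      have hd' : g * lmin ≤ d := by
        rcases hd with hd | hd
        · omega
        · exact hd.2
      have hb := packetLength_pos h0 h1 b
      refine ⟨Or.inr ⟨by simp [algSLPreamble, hm], by linarith⟩, ?_⟩
      intro e t he het hlt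
      have h2 := hO.gain_of_error e t he het
      have h3 : lmax / (g * lmin) * (g * lmin) = lmax := by field_simp
      have h4 := mul_le_mul_of_nonneg_left hd' hpos
      have h5 := packetLength_le h1 b
      linarith
    cases b with
    | false => exact hafter (preamble_pick_long hmem hp)
    | true =>
      rcases preamble_pick_short hmem hp with hm | ⟨hm, _⟩
      · intro d hd
        have hd' : ∃ j : ℕ, cfg.mem + j = g ∧ d = j * lmin := by
          rcases hd with hd | ⟨hi, _⟩
          · exact hd.2
          · exact absurd hi hm.ne'
        obtain ⟨j, hj, rfl⟩ := hd'
        refine ⟨?_, ?_⟩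
        · simp only [algSLPreamble, packetLength, if_true]
          rcases Nat.lt_or_ge 1 cfg.mem with hm1 | hm1
          · exact Or.inl ⟨by omega, j + 1, by omega, by push_cast; ring⟩
          · have : g = j + 1 := by omega
            exact Or.inr ⟨by omega, by rw [this]; push_cast; linarith⟩
        · intro e t he het hlt
          obtain ⟨x, y, hx, hy, hxy⟩ := hO.exists_gain he het
          simp only [hx, hy, packetLength, if_true] at hlt ⊢
          have hjg : ((j : ℝ) + 1) * lmin ≤ g * lmin := by
            have : ((j + 1 : ℕ) : ℝ) ≤ g := by exact_mod_cast (by omega : j + 1 ≤ g)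
            push_cast at this
            gcongr
          have hx0 : 0 ≤ (x : ℝ) * lmin := by positivity
          have hy0 : (y : ℝ) * lmax < 1 * lmax := by linarith
          have hy1 : y = 0 := by
            have := lt_of_mul_lt_mul_right hy0 hmax.le
            have : y < 1 := by exact_mod_cast this
            omega
          subst hy1
          have hx1 : (x : ℝ) * lmin < ((j + 1 : ℕ) : ℝ) * lmin := by
            push_cast at hxy ⊢; linarith
          have hx2 : x ≤ j := by
            have := lt_of_mul_lt_mul_right hx1 h0.le
            have : x < j + 1 := by exact_mod_cast this
            omega
          have hx3 : (x : ℝ) * lmin ≤ j * lmin := by gcongr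
          have : 0 ≤ lmax / (g * lmin) * (j * lmin) := by positivity
          push_cast; linarith
      · exact hafter hm
  · intro k m cfg
    by_cases hps : g ≤ cfg.pendingShort A
    · left; left
      simp only [algSLPreamble, if_pos hps]
      exact ⟨hg0, 0, by simp⟩
    · right
      -- Short and long packets are bounded separately: fewer than `g` short ones are undelivered,
      -- and the other potential bounds the long ones. Adding up gives `1 + lmax / (g * lmin)` and
      -- the constant `g * lmin + 2 * lmax`.
      have hlong : (O false cfg.time : ℝ) * lmax ≤
          lmax / (g * lmin) * cfg.sent lmin lmax + (0 + 2 * lmax) :=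
        (isPotential_preamble_long h0 h1 hr hO hg0 hg).le_at_decision h0 h1 hr k
      have hshort := hO.le_arrived true cfg.time cfg.time le_rfl fun n hn => lt_asymm hn.1 hn.2
      have h2 : O true cfg.time ≤ cfg.sentShort + g := by
        unfold Config.pendingShort at hps; omega
      have h3 : (O true cfg.time : ℝ) * lmin ≤ (cfg.sentShort + g) * lmin := by
        have : (O true cfg.time : ℝ) ≤ cfg.sentShort + g := by exact_mod_cast h2
        gcongr
      have h4 : (cfg.sentShort : ℝ) * lmin ≤ cfg.sent lmin lmax := by
        have : 0 ≤ (cfg.sentLong : ℝ) * lmax := by positivity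
        unfold Config.sent; linarith
      linarith

/-! ### From potentials to bounds on the offline optimum -/

theorem sent_le_algLength {k : ℕ} {t : ℝ} (h : (execution lmin lmax alg A E k).time ≤ t) :
    ENNReal.ofReal ((execution lmin lmax alg A E k).sent lmin lmax) ≤
      algLength lmin lmax alg A E t :=
  le_iSup₂_of_le k h le_rfl

theorem optLength_le_of_isPotential (h0 : 0 < lmin) (h1 : lmin < lmax) (hr : IsRegular A E)
    {κ C : ℝ} {Q : ℕ → ℝ → Prop}
    (hpot : ∀ O, IsOfflineCount lmin lmax A E O →
      IsPotential lmin lmax alg A E (fun t => O true t * lmin + O false t * lmax) κ C Q)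
    {t : ℝ} (ht : 0 ≤ t) :
    optLength lmin lmax A E t ≤ ENNReal.ofReal κ * algLength lmin lmax alg A E t +
      ENNReal.ofReal (C + 2 * lmax) := by
  refine optLength_le_of_forall_isOfflineCount h0 h1 hr fun O hO => ?_
  have h := hpot O hO
  obtain ⟨k, hk, hle⟩ := h.exists_le h0 h1 hr ht
  refine (ENNReal.ofReal_le_ofReal hle).trans (ENNReal.ofReal_add_le.trans ?_)
  rw [ENNReal.ofReal_mul (zero_le_one.trans h.one_le)]
  gcongr
  exact sent_le_algLength hk

theorem optLength_le_algSL (h0 : 0 < lmin) (h1 : lmin < lmax) (hr : IsRegular A E)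
    {g : ℕ} (hg : g * lmin ≤ lmax) {c D : ℝ} (hc : 0 < c)
    (hcg : c * lmax ≤ g * lmin) (hD : 0 ≤ D)
    (harr : ∀ t, 0 ≤ t → c * t - D ≤ arrived A true t * lmin) {t : ℝ} (ht : 0 ≤ t) :
    optLength lmin lmax A E t ≤ ENNReal.ofReal (1 / c) * algLength lmin lmax algSL A E t +
      ENNReal.ofReal (D / c + 2 * lmax) :=
  optLength_le_of_isPotential h0 h1 hr
    (fun _ hO => isPotential_algSL h0 h1 hr hO hg hc hcg hD harr) ht

theorem optLength_le_algSLPreamble (h0 : 0 < lmin) (h1 : lmin < lmax) (hr : IsRegular A E)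
    {g : ℕ} (hg0 : 0 < g) (hg : g * lmin ≤ lmax) {t : ℝ} (ht : 0 ≤ t) :
    optLength lmin lmax A E t ≤ ENNReal.ofReal (1 + lmax / (g * lmin)) *
      algLength lmin lmax (algSLPreamble g) A E t +
      ENNReal.ofReal (g * lmin + 2 * lmax + 2 * lmax) :=
  optLength_le_of_isPotential h0 h1 hr
    (fun _ hO => isPotential_preamble h0 h1 hr hO hg0 hg) ht

end

section

/-! ### Measurability of the execution -/

theorem measurable_arrivalTime (n : ℕ) : Measurable fun A : ArrivalPattern => arrivalTime A n :=
  Finset.measurable_sum _ fun i _ => (measurable_pi_apply i).fst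

theorem measurable_kind (n : ℕ) : Measurable fun A : ArrivalPattern => (A n).2 :=
  (measurable_pi_apply n).snd

theorem history_le (t : ℝ) : history t ≤ (inferInstance : MeasurableSpace ArrivalPattern) := by
  refine MeasurableSpace.generateFrom_le ?_
  rintro S ⟨n, s, b, _, rfl⟩
  exact (measurableSet_le (measurable_arrivalTime n) measurable_const).inter
    (measurable_kind n (measurableSet_singleton b))

/-- The cardinality is a countable sum of indicators. For infinite sets `toReal` sends `∞` to `0`,
in agreement with the default value of `ncard`. -/
theorem measurable_ncard {Ω : Type*} [MeasurableSpace Ω] {S : Ω → Set ℕ}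
    (hS : ∀ n, MeasurableSet {x | n ∈ S x}) : Measurable fun x => (S x).ncard := by
  classical
  have heq : ∀ x, (S x).ncard =
      ⌊(∑' n : ℕ, if n ∈ S x then (1 : ℝ≥0∞) else 0).toReal⌋₊ := by
    intro x
    have h1 : (∑' n : ℕ, if n ∈ S x then (1 : ℝ≥0∞) else 0) = (S x).encard := by
      rw [← ENNReal.tsum_set_one, tsum_subtype (S x) fun _ => (1 : ℝ≥0∞)]
      rfl
    rw [h1]
    rcases (S x).finite_or_infinite with h | h
    · rw [← h.cast_ncard_eq]; simp
    · simp [h.ncard, h.encard_eq]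
  simp_rw [heq]
  refine Nat.measurable_floor.comp (Measurable.ennreal_toReal (Measurable.tsum fun n => ?_))
  exact Measurable.ite (hS n) measurable_const measurable_const

theorem measurable_arrived {τ : ArrivalPattern → ℝ} (hτ : Measurable τ) (b : Bool) :
    Measurable fun A => arrived A b (τ A) :=
  measurable_ncard fun n => (measurable_kind n (measurableSet_singleton b)).inter
    (measurableSet_le (measurable_arrivalTime n) hτ)

theorem measurable_sInf {Ω : Type*} [MeasurableSpace Ω] {U : Ω → Set ℝ}
    (hbdd : ∀ x, BddBelow (U x)) (hU : ∀ r : ℝ, MeasurableSet {x | ∃ u ∈ U x, u < r}) :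
    Measurable fun x => sInf (U x) := by
  refine measurable_of_Iio fun r => ?_
  -- The second part accounts for empty `U x`, where `sInf` is `0`.
  have heq : (fun x => sInf (U x)) ⁻¹' Iio r = {x | ∃ u ∈ U x, u < r} ∪
      ((⋂ n : ℕ, {x | ∃ u ∈ U x, u < n}ᶜ) ∩ {_x | 0 < r}) := by
    ext x
    simp only [mem_preimage, mem_Iio, mem_union, mem_ofPred_eq, mem_inter_iff, mem_iInter,
      mem_compl_iff]
    rcases (U x).eq_empty_or_nonempty with h | h
    · simp [h]
    · rw [csInf_lt_iff (hbdd x) h]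
      constructor
      · exact Or.inl
      · rintro (h' | ⟨h', _⟩)
        · exact h'
        · obtain ⟨u, hu⟩ := h
          obtain ⟨n, hn⟩ := exists_nat_gt u
          exact absurd ⟨u, hu, hn⟩ (h' n)
  rw [heq]
  exact (hU r).union ((MeasurableSet.iInter fun n : ℕ => (hU n).compl).inter (.const _))

/-- A measurable family of locally finite sets of error times. -/
structure IsMeasurableErrors (E : ArrivalPattern → Set ℝ) : Prop where
  measurable : ∀ a b : ℝ, 0 ≤ a → a ≤ b →
    MeasurableSet {A : ArrivalPattern | (E A ∩ Icc a b).Nonempty}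
  finite : ∀ A, ∀ t : ℝ, (E A ∩ Icc 0 t).Finite

variable {E : ArrivalPattern → Set ℝ}

theorem IsMeasurableErrors.between (hE : IsMeasurableErrors E) {x y : ArrivalPattern → ℝ}
    (hx : Measurable x) (hy : Measurable y) (hx0 : ∀ A, 0 ≤ x A) :
    MeasurableSet {A | ∃ e ∈ E A, x A < e ∧ e < y A} := by
  have heq : {A | ∃ e ∈ E A, x A < e ∧ e < y A} =
      ⋃ (q : ℚ) (r : ℚ) (_ : (0 : ℝ) ≤ q ∧ (q : ℝ) ≤ r),
        {A | x A < q} ∩ {A | r < y A} ∩ {A | (E A ∩ Icc (q : ℝ) r).Nonempty} := by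
    ext A
    simp only [mem_ofPred_eq, mem_iUnion, mem_inter_iff, exists_prop]
    constructor
    · rintro ⟨e, he, h1, h2⟩
      obtain ⟨q, hq1, hq2⟩ := exists_rat_btwn h1
      obtain ⟨r, hr1, hr2⟩ := exists_rat_btwn h2
      exact ⟨q, r, ⟨(hx0 A).trans hq1.le, (hq2.trans hr1).le⟩, ⟨hq1, hr2⟩, e, he, hq2.le, hr1.le⟩
    · rintro ⟨q, r, _, ⟨h1, h2⟩, e, he, h3, h4⟩
      exact ⟨e, he, h1.trans_le h3, h4.trans_lt h2⟩
  rw [heq]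
  refine MeasurableSet.iUnion fun q => MeasurableSet.iUnion fun r => MeasurableSet.iUnion fun h => ?_
  exact ((measurableSet_lt hx measurable_const).inter (measurableSet_lt measurable_const hy)).inter
    (hE.measurable _ _ h.1 h.2)

/-- By local finiteness the errors form a closed set on bounded intervals. So `τ A` is an error if
and only if, for every mesh `1 / (n + 1)`, some grid cell containing `τ A` also contains an error.
-/
theorem IsMeasurableErrors.mem (hE : IsMeasurableErrors E) {τ : ArrivalPattern → ℝ}
    (hτ : Measurable τ) (hτ0 : ∀ A, 0 ≤ τ A) : MeasurableSet {A | τ A ∈ E A} := by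
  have heq : {A | τ A ∈ E A} = ⋂ n : ℕ, ⋃ j : ℕ, {A | (j : ℝ) / (n + 1) ≤ τ A} ∩
      {A | τ A ≤ ((j : ℝ) + 1) / (n + 1)} ∩
      {A | (E A ∩ Icc ((j : ℝ) / (n + 1)) (((j : ℝ) + 1) / (n + 1))).Nonempty} := by
    ext A
    simp only [mem_ofPred_eq, mem_iInter, mem_iUnion, mem_inter_iff]
    constructor
    · intro h n
      have hn : (0 : ℝ) < n + 1 := by positivity
      have h1 : (⌊τ A * (n + 1)⌋₊ : ℝ) / (n + 1) ≤ τ A := by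
        rw [div_le_iff₀ hn]
        exact Nat.floor_le (mul_nonneg (hτ0 A) hn.le)
      have h2 : τ A ≤ ((⌊τ A * (n + 1)⌋₊ : ℝ) + 1) / (n + 1) := by
        rw [le_div_iff₀ hn]
        exact (Nat.lt_floor_add_one _).le
      exact ⟨_, ⟨h1, h2⟩, τ A, h, h1, h2⟩
    · intro h
      have hcl : τ A ∈ closure (E A ∩ Icc 0 (τ A + 1)) := by
        refine Metric.mem_closure_iff.2 fun ε hε => ?_
        obtain ⟨n, hn⟩ := exists_nat_one_div_lt hε
        obtain ⟨j, ⟨h1, h2⟩, e, he, h3, h4⟩ := h n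
        have hpos : (0 : ℝ) < n + 1 := by positivity
        have hj : (0 : ℝ) ≤ (j : ℝ) / (n + 1) := by positivity
        have h5 : 1 / ((n : ℝ) + 1) ≤ 1 := by
          rw [div_le_one hpos]; linarith [(Nat.cast_nonneg n : (0 : ℝ) ≤ n)]
        rw [add_div] at h2 h4
        refine ⟨e, ⟨he, hj.trans h3, by linarith⟩, ?_⟩
        rw [Real.dist_eq]
        exact (abs_le.2 ⟨by linarith, by linarith⟩).trans_lt hn
      rw [(hE.finite A _).isClosed.closure_eq] at hcl
      exact hcl.1
  rw [heq]
  refine MeasurableSet.iInter fun n => MeasurableSet.iUnion fun j => ?_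
  refine ((measurableSet_le measurable_const hτ).inter
    (measurableSet_le hτ measurable_const)).inter (hE.measurable _ _ (by positivity) ?_)
  gcongr; linarith

/-- A configuration that depends measurably on the arrivals. -/
structure IsMeasurableConfig (f : ArrivalPattern → Config) : Prop where
  time : Measurable fun A => (f A).time
  mem : Measurable fun A => (f A).mem
  sentShort : Measurable fun A => (f A).sentShort
  sentLong : Measurable fun A => (f A).sentLong
  nonneg : ∀ A, 0 ≤ (f A).time

variable {f g : ArrivalPattern → Config} {lmin lmax : ℝ} {alg : OnlineAlg}

theorem IsMeasurableConfig.ite (hf : IsMeasurableConfig f) (hg : IsMeasurableConfig g)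
    {p : ArrivalPattern → Prop} [DecidablePred p] (hp : MeasurableSet {A | p A}) :
    IsMeasurableConfig fun A => if p A then f A else g A where
  time := by simp only [apply_ite Config.time]; exact hf.time.ite hp hg.time
  mem := by simp only [apply_ite Config.mem]; exact hf.mem.ite hp hg.mem
  sentShort := by simp only [apply_ite Config.sentShort]; exact hf.sentShort.ite hp hg.sentShort
  sentLong := by simp only [apply_ite Config.sentLong]; exact hf.sentLong.ite hp hg.sentLong
  nonneg A := by split_ifs <;> [exact hf.nonneg A; exact hg.nonneg A]

theorem IsMeasurableConfig.pending (hf : IsMeasurableConfig f) :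
    Measurable fun A => ((f A).mem, (f A).pendingShort A, (f A).pendingLong A) :=
  hf.mem.prodMk (((measurable_arrived hf.time true).sub hf.sentShort).prodMk
    ((measurable_arrived hf.time false).sub hf.sentLong))

theorem IsMeasurableConfig.notify (hf : IsMeasurableConfig f) :
    IsMeasurableConfig fun A => (f A).notify alg A where
  time := hf.time
  mem := (measurable_of_countable fun x : ℕ × ℕ × ℕ => alg.restart x.1 x.2.1 x.2.2).comp hf.pending
  sentShort := hf.sentShort
  sentLong := hf.sentLong
  nonneg := hf.nonneg

open Classical in
theorem IsMeasurableConfig.notifyIf (hE : IsMeasurableErrors E) (hf : IsMeasurableConfig f) :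
    IsMeasurableConfig fun A => (f A).notifyIf alg A (E A) :=
  hf.notify.ite hf (hE.mem hf.time hf.nonneg)

theorem IsMeasurableConfig.withTime (hf : IsMeasurableConfig f) {τ : ArrivalPattern → ℝ}
    (hτ : Measurable τ) (h0 : ∀ A, 0 ≤ τ A) :
    IsMeasurableConfig fun A => { f A with time := τ A } :=
  ⟨hτ, hf.mem, hf.sentShort, hf.sentLong, h0⟩

theorem IsMeasurableConfig.deliver (h0 : 0 < lmin) (h1 : lmin < lmax) (hf : IsMeasurableConfig f)
    (b : Bool) : IsMeasurableConfig fun A => (f A).deliver lmin lmax alg b where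
  time := hf.time.add_const _
  mem := (measurable_of_countable alg.next).comp hf.mem
  sentShort := by
    cases b
    · exact hf.sentShort
    · exact hf.sentShort.add_const 1
  sentLong := by
    cases b
    · exact hf.sentLong.add_const 1
    · exact hf.sentLong
  nonneg A := add_nonneg (hf.nonneg A) (packetLength_pos h0 h1 b).le

open Classical in
theorem IsMeasurableConfig.step (h0 : 0 < lmin) (h1 : lmin < lmax) (hE : IsMeasurableErrors E)
    (hf : IsMeasurableConfig f) :
    IsMeasurableConfig fun A => (f A).step lmin lmax alg A (E A) := by
  have hpick : ∀ o, MeasurableSet {A | alg.pick (f A).mem ((f A).pendingShort A)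
      ((f A).pendingLong A) = o} := fun o =>
    hf.pending ((Set.to_countable
      {x : ℕ × ℕ × ℕ | alg.pick x.1 x.2.1 x.2.2 = o}).measurableSet)
  set U : ArrivalPattern → Set ℝ := fun A =>
    {u : ℝ | (f A).time < u ∧ (u ∈ range (arrivalTime A) ∨ u ∈ E A)} with hU
  set W : ArrivalPattern → Set ℝ := fun A => {e : ℝ | e ∈ E A ∧ (f A).time < e} with hW
  have hUlt : ∀ r : ℝ, MeasurableSet {A | ∃ u ∈ U A, u < r} := by
    intro r
    have : {A | ∃ u ∈ U A, u < r} =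
        (⋃ n : ℕ, {A | (f A).time < arrivalTime A n} ∩ {A | arrivalTime A n < r}) ∪
        {A | ∃ e ∈ E A, (f A).time < e ∧ e < r} := by
      ext A
      simp only [hU, mem_ofPred_eq, mem_union, mem_iUnion, mem_inter_iff]
      constructor
      · rintro ⟨u, ⟨h1, ⟨n, rfl⟩ | h2⟩, h3⟩
        · exact Or.inl ⟨n, h1, h3⟩
        · exact Or.inr ⟨u, h2, h1, h3⟩
      · rintro (⟨n, h1, h3⟩ | ⟨u, h2, h1, h3⟩)
        · exact ⟨_, ⟨h1, Or.inl ⟨n, rfl⟩⟩, h3⟩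
        · exact ⟨u, ⟨h1, Or.inr h2⟩, h3⟩
    rw [this]
    exact (MeasurableSet.iUnion fun n =>
      (measurableSet_lt hf.time (measurable_arrivalTime n)).inter
        (measurableSet_lt (measurable_arrivalTime n) measurable_const)).union
      (hE.between hf.time measurable_const hf.nonneg)
  have hWlt : ∀ r : ℝ, MeasurableSet {A | ∃ u ∈ W A, u < r} := by
    intro r
    have : {A | ∃ u ∈ W A, u < r} = {A | ∃ e ∈ E A, (f A).time < e ∧ e < r} := by
      ext A; simp [hW, and_assoc]
    rw [this]
    exact hE.between hf.time measurable_const hf.nonneg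
  have hU0 : ∀ A, ∀ u ∈ U A, 0 ≤ u := fun A u hu => (hf.nonneg A).trans hu.1.le
  have hW0 : ∀ A, ∀ u ∈ W A, 0 ≤ u := fun A u hu => (hf.nonneg A).trans hu.2.le
  have hne : MeasurableSet {A | (U A).Nonempty} := by
    have : {A | (U A).Nonempty} = ⋃ n : ℕ, {A | ∃ u ∈ U A, u < n} := by
      ext A
      simp only [mem_ofPred_eq, mem_iUnion]
      constructor
      · rintro ⟨u, hu⟩
        obtain ⟨n, hn⟩ := exists_nat_gt u
        exact ⟨n, u, hu, hn⟩
      · rintro ⟨_, u, hu, _⟩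
        exact ⟨u, hu⟩
    rw [this]
    exact MeasurableSet.iUnion fun n : ℕ => hUlt n
  have hidle := ((hf.withTime (measurable_sInf (fun A => ⟨0, hU0 A⟩) hUlt)
    fun A => Real.sInf_nonneg (hU0 A)).notifyIf (alg := alg) hE).ite hf hne
  have hsend : ∀ b, IsMeasurableConfig fun A =>
      if ∃ e ∈ E A, (f A).time < e ∧ e < (f A).time + packetLength lmin lmax b then
        Config.notifyIf alg A (E A) { f A with time := sInf (W A) }
      else Config.notifyIf alg A (E A) ((f A).deliver lmin lmax alg b) := fun b =>
    ((hf.withTime (measurable_sInf (fun A => ⟨0, hW0 A⟩) hWlt)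
      fun A => Real.sInf_nonneg (hW0 A)).notifyIf hE).ite ((hf.deliver h0 h1 b).notifyIf hE)
      (hE.between hf.time (hf.time.add_const _) hf.nonneg)
  have := hidle.ite ((hsend true).ite (hsend false) (hpick (some true))) (hpick none)
  convert this using 2 with A
  unfold Config.step
  rcases alg.pick (f A).mem ((f A).pendingShort A) ((f A).pendingLong A) with _ | _ | _ <;> simp [hU, hW]

theorem isMeasurableConfig_execution (h0 : 0 < lmin) (h1 : lmin < lmax)
    (hE : IsMeasurableErrors E) (k : ℕ) :
    IsMeasurableConfig fun A => execution lmin lmax alg A (E A) k := by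
  induction k with
  | zero =>
    exact IsMeasurableConfig.notify ⟨measurable_const, measurable_const, measurable_const,
      measurable_const, fun _ => le_rfl⟩
  | succ k ih => exact ih.step h0 h1 hE

end

section

/-! ### Laws of large numbers for the arrivals -/

theorem expMeasure_eq_withDensity (lam : ℝ) :
    expMeasure lam = volume.withDensity (exponentialPDF lam) := rfl

theorem measurable_exponentialPDF (lam : ℝ) : Measurable (exponentialPDF lam) :=
  (measurable_exponentialPDFReal lam).ennreal_ofReal

theorem ae_nonneg_expMeasure (lam : ℝ) : ∀ᵐ x ∂(expMeasure lam), 0 ≤ x := by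
  have : {x : ℝ | ¬ 0 ≤ x} = Iio 0 := by ext; simp
  rw [ae_iff, this, expMeasure_eq_withDensity, withDensity_apply _ measurableSet_Iio]
  exact lintegral_exponentialPDF_of_nonpos le_rfl

theorem lintegral_expMeasure {lam : ℝ} (hlam : 0 < lam) :
    ∫⁻ x, ENNReal.ofReal x ∂(expMeasure lam) = ENNReal.ofReal (1 / lam) := by
  rw [expMeasure_eq_withDensity, lintegral_withDensity_eq_lintegral_mul _
    (measurable_exponentialPDF lam) ENNReal.measurable_ofReal]
  -- Multiplying the exponential density by `x` gives `1 / lam` times the Gamma density of shape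
  -- `2`, whose integral is `1`.
  have : ∀ x, (exponentialPDF lam * fun x => ENNReal.ofReal x) x =
      ENNReal.ofReal (1 / lam) * gammaPDF 2 lam x := by
    intro x
    rcases lt_or_ge x 0 with hx | hx
    · simp [exponentialPDF_of_neg hx, gammaPDF_of_neg hx]
    · rw [Pi.mul_apply, exponentialPDF_of_nonneg hx, gammaPDF_of_nonneg hx,
        ← ENNReal.ofReal_mul (by positivity), ← ENNReal.ofReal_mul (by positivity)]
      congr 1
      have h2 : (2 : ℝ) - 1 = 1 := by norm_num
      rw [Real.Gamma_two, h2, Real.rpow_one, Real.rpow_two]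
      field_simp
  rw [lintegral_congr this, lintegral_const_mul _
    (show Measurable (gammaPDF 2 lam) from (measurable_gammaPDFReal 2 lam).ennreal_ofReal),
    lintegral_gammaPDF_eq_one two_pos hlam, mul_one]

theorem integrable_id_expMeasure {lam : ℝ} (hlam : 0 < lam) :
    Integrable (fun x : ℝ => x) (expMeasure lam) := by
  refine ⟨measurable_id.aestronglyMeasurable, ?_⟩
  rw [hasFiniteIntegral_iff_ofReal (ae_nonneg_expMeasure lam), lintegral_expMeasure hlam]
  exact ENNReal.ofReal_lt_top

theorem integral_id_expMeasure {lam : ℝ} (hlam : 0 < lam) :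
    ∫ x, x ∂(expMeasure lam) = 1 / lam := by
  rw [integral_eq_lintegral_of_nonneg_ae (ae_nonneg_expMeasure lam)
    measurable_id.aestronglyMeasurable, lintegral_expMeasure hlam,
    ENNReal.toReal_ofReal (by positivity)]

theorem integral_kindLaw {p : ℝ} (h0 : 0 < p) :
    ∫ b, (if b then (1 : ℝ) else 0) ∂(kindLaw p) = p := by
  have h : ∀ μ : Measure Bool, IsFiniteMeasure μ →
      Integrable (fun b : Bool => if b then (1 : ℝ) else 0) μ := fun μ _ => .of_finite
  rw [kindLaw, integral_add_measure, integral_smul_measure, integral_smul_measure,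
    integral_dirac, integral_dirac]
  · simp [h0.le]
  · exact (h _ inferInstance).smul_measure ENNReal.ofReal_ne_top
  · exact (h _ inferInstance).smul_measure ENNReal.ofReal_ne_top

/-! ### Strong laws for interarrival times and packet kinds -/

variable {lam p : ℝ}

theorem ae_tendsto_average (hlam : 0 < lam) (h0 : 0 < p) (h1 : p < 1) {φ : ℝ × Bool → ℝ}
    (hφ : Measurable φ) (hint : Integrable φ ((expMeasure lam).prod (kindLaw p))) :
    ∀ᵐ A ∂(arrivalLaw lam p), Tendsto (fun n : ℕ => (∑ i ∈ Finset.range n, φ (A i)) / n) atTop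
      (𝓝 (∫ x, φ x ∂((expMeasure lam).prod (kindLaw p)))) := by
  have := isProbabilityMeasure_kindLaw h0 h1
  have := isProbabilityMeasure_expMeasure hlam
  have hmp : ∀ i, MeasurePreserving (fun A : ArrivalPattern => A i) (arrivalLaw lam p)
      ((expMeasure lam).prod (kindLaw p)) := fun i =>
    measurePreserving_eval_infinitePi (fun _ : ℕ => (expMeasure lam).prod (kindLaw p)) i
  have hindep : iIndepFun (fun (i : ℕ) (A : ArrivalPattern) => φ (A i)) (arrivalLaw lam p) :=
    iIndepFun_infinitePi (P := fun _ : ℕ => (expMeasure lam).prod (kindLaw p))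
      (X := fun _ => φ) fun _ => hφ
  have hmap : ∀ i, (arrivalLaw lam p).map (fun A : ArrivalPattern => φ (A i)) =
      ((expMeasure lam).prod (kindLaw p)).map φ := fun i => by
    rw [← (hmp i).map_eq, Measure.map_map hφ (hmp i).measurable]; rfl
  have h := strong_law_ae_real (μ := arrivalLaw lam p) (fun i A => φ (A i))
    ((hmp 0).integrable_comp_of_integrable hint) (fun i j hij => hindep.indepFun hij)
    fun i => ⟨(hφ.comp (hmp i).measurable).aemeasurable, (hφ.comp (hmp 0).measurable).aemeasurable,
      by rw [hmap, hmap]⟩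
  have hmean : ∫ A, φ (A 0) ∂(arrivalLaw lam p) =
      ∫ x, φ x ∂((expMeasure lam).prod (kindLaw p)) := by
    rw [← (hmp 0).map_eq, integral_map (hmp 0).measurable.aemeasurable hφ.aestronglyMeasurable]
  rwa [hmean] at h

theorem ae_tendsto_arrivalTime_div (hlam : 0 < lam) (h0 : 0 < p) (h1 : p < 1) :
    ∀ᵐ A ∂(arrivalLaw lam p), Tendsto (fun n : ℕ => (∑ i ∈ Finset.range n, (A i).1 : ℝ) / n) atTop
      (𝓝 (1 / lam)) := by
  have := isProbabilityMeasure_kindLaw h0 h1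
  have := isProbabilityMeasure_expMeasure hlam
  have h := ae_tendsto_average hlam h0 h1 (φ := Prod.fst) measurable_fst
    ((integrable_id_expMeasure hlam).comp_fst (kindLaw p))
  rw [integral_fun_fst (μ := expMeasure lam) (ν := kindLaw p) (fun x : ℝ => x),
    integral_id_expMeasure hlam, probReal_univ, one_smul] at h
  exact h

/-- The number of short packets among the first `n` packets. -/
noncomputable def shortCount (A : ArrivalPattern) (n : ℕ) : ℝ :=
  ∑ i ∈ Finset.range n, if (A i).2 then 1 else 0

theorem ae_tendsto_shortCount_div (hlam : 0 < lam) (h0 : 0 < p) (h1 : p < 1) :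
    ∀ᵐ A ∂(arrivalLaw lam p), Tendsto (fun n : ℕ => shortCount A n / n) atTop (𝓝 p) := by
  have := isProbabilityMeasure_kindLaw h0 h1
  have := isProbabilityMeasure_expMeasure hlam
  have h := ae_tendsto_average hlam h0 h1 (φ := fun x => if x.2 then 1 else 0)
    (Measurable.ite (measurable_snd (measurableSet_singleton true)) measurable_const
      measurable_const)
    ((Integrable.of_finite (f := fun b : Bool => if b then (1 : ℝ) else 0)).comp_snd
      (expMeasure lam))
  rw [integral_fun_snd (μ := expMeasure lam) (ν := kindLaw p)
    (fun b : Bool => if b then (1 : ℝ) else 0), integral_kindLaw h0, probReal_univ, one_smul] at h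
  exact h

theorem ae_interarrival_nonneg (hlam : 0 < lam) (h0 : 0 < p) (h1 : p < 1) :
    ∀ᵐ A ∂(arrivalLaw lam p), ∀ i, 0 ≤ (A i).1 := by
  have := isProbabilityMeasure_kindLaw h0 h1
  have := isProbabilityMeasure_expMeasure hlam
  refine ae_all_iff.2 fun i => ?_
  have hmp : MeasurePreserving (fun A : ArrivalPattern => A i) (arrivalLaw lam p)
      ((expMeasure lam).prod (kindLaw p)) :=
    measurePreserving_eval_infinitePi (fun _ : ℕ => (expMeasure lam).prod (kindLaw p)) i
  have hfst : MeasurePreserving (Prod.fst : ℝ × Bool → ℝ) ((expMeasure lam).prod (kindLaw p))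
    (expMeasure lam) := measurePreserving_fst
  exact (hfst.comp hmp).quasiMeasurePreserving.ae (ae_nonneg_expMeasure lam)

theorem ae_tendsto_arrivalTime (hlam : 0 < lam) (h0 : 0 < p) (h1 : p < 1) :
    ∀ᵐ A ∂(arrivalLaw lam p), Tendsto (arrivalTime A) atTop atTop := by
  filter_upwards [ae_tendsto_arrivalTime_div hlam h0 h1] with A hA
  have h := hA.pos_mul_atTop (one_div_pos.2 hlam) tendsto_natCast_atTop_atTop
  have h' : Tendsto (fun n : ℕ => ∑ i ∈ Finset.range n, (A i).1) atTop atTop := by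
    refine h.congr' ?_
    filter_upwards [eventually_gt_atTop 0] with n hn
    have : (n : ℝ) ≠ 0 := by positivity
    field_simp
  exact h'.comp (tendsto_add_atTop_nat 1)

/-- The arrival patterns for which, from packet `K` on, the packets arrive on average with rate at
least `1 / α`, and a fraction of at least `β` of them is short. -/
def typicalArrivals (α β : ℝ) (K : ℕ) : Set ArrivalPattern :=
  {A | ∀ n, K ≤ n → ∑ i ∈ Finset.range n, (A i).1 ≤ α * n ∧ β * n ≤ shortCount A n}

theorem monotone_typicalArrivals (α β : ℝ) : Monotone (typicalArrivals α β) :=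
  fun _ _ hKL _ hA n hn => hA n (hKL.trans hn)

theorem measurable_shortCount (n : ℕ) : Measurable fun A : ArrivalPattern => shortCount A n :=
  Finset.measurable_sum _ fun i _ =>
    Measurable.ite (measurable_kind i (measurableSet_singleton true)) measurable_const
      measurable_const

theorem measurableSet_typicalArrivals (α β : ℝ) (K : ℕ) :
    MeasurableSet (typicalArrivals α β K) := by
  have : typicalArrivals α β K = ⋂ (n : ℕ) (_ : K ≤ n),
      {A | ∑ i ∈ Finset.range n, (A i).1 ≤ α * n} ∩ {A | β * n ≤ shortCount A n} := by
    ext A; simp [typicalArrivals]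
  rw [this]
  refine MeasurableSet.iInter fun n => MeasurableSet.iInter fun _ => ?_
  exact (measurableSet_le (Finset.measurable_sum _ fun i _ => (measurable_pi_apply i).fst)
    measurable_const).inter (measurableSet_le measurable_const (measurable_shortCount n))

theorem ae_mem_typicalArrivals (hlam : 0 < lam) (h0 : 0 < p) (h1 : p < 1) {α β : ℝ}
    (hα : 1 / lam < α) (hβ : β < p) :
    ∀ᵐ A ∂(arrivalLaw lam p), ∃ K, A ∈ typicalArrivals α β K := by
  filter_upwards [ae_tendsto_arrivalTime_div hlam h0 h1, ae_tendsto_shortCount_div hlam h0 h1]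
    with A hA hB
  obtain ⟨K, hK⟩ := eventually_atTop.1 ((hA.eventually_lt_const hα).and
    (hB.eventually_const_lt hβ))
  refine ⟨K + 1, fun n hn => ?_⟩
  have hn0 : (0 : ℝ) < n := by exact_mod_cast (by omega : 0 < n)
  obtain ⟨h2, h3⟩ := hK n (by omega)
  rw [div_lt_iff₀ hn0] at h2
  rw [lt_div_iff₀ hn0] at h3
  exact ⟨h2.le, h3.le⟩

theorem shortCount_le_arrived {A : ArrivalPattern} (hnn : ∀ i, 0 ≤ (A i).1)
    (hA : Tendsto (arrivalTime A) atTop atTop) {n : ℕ} {t : ℝ}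
    (h : ∑ i ∈ Finset.range n, (A i).1 ≤ t) : shortCount A n ≤ arrived A true t := by
  have hcard : shortCount A n = ((Finset.range n).filter fun i => (A i).2 = true).card := by
    rw [shortCount, Finset.sum_ite]; simp
  rw [hcard, arrived, ← ncard_coe_finset]
  refine Nat.cast_le.2 (ncard_le_ncard ?_ (finite_arrivals_kind hA true t))
  intro i hi
  simp only [Finset.coe_filter, Finset.mem_range, mem_ofPred_eq] at hi
  refine ⟨hi.2, le_trans ?_ h⟩
  exact Finset.sum_le_sum_of_subset_of_nonneg
    (Finset.range_subset_range.2 hi.1) fun j _ _ => hnn j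

/-- Take `n = ⌊t / α⌋₊`. If `K ≤ n`, the first `n` packets have arrived by `t`, at least `β * n` of
them short; rounding costs `β`. If `n < K`, the left side is not positive. -/
theorem le_arrived_of_mem_typicalArrivals {A : ArrivalPattern} (hnn : ∀ i, 0 ≤ (A i).1)
    (hA : Tendsto (arrivalTime A) atTop atTop) {α β : ℝ} (hα : 0 < α) (hβ : 0 < β) {K : ℕ}
    (hK : A ∈ typicalArrivals α β K) {t : ℝ} (ht : 0 ≤ t) :
    β / α * t - β * (K + 1) ≤ arrived A true t := by
  have hfl : t / α < (⌊t / α⌋₊ : ℝ) + 1 := Nat.lt_floor_add_one _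
  have heq : β / α * t = β * (t / α) := by ring
  rw [heq]
  rcases le_or_gt K ⌊t / α⌋₊ with h | h
  · obtain ⟨h1, h2⟩ := hK _ h
    have h3 : α * (⌊t / α⌋₊ : ℝ) ≤ t := by
      have := Nat.floor_le (show 0 ≤ t / α by positivity)
      rw [le_div_iff₀ hα] at this; linarith
    have h4 := shortCount_le_arrived hnn hA (h1.trans h3)
    have h5 : 0 ≤ β * K := by positivity
    nlinarith
  · have h2 : ((⌊t / α⌋₊ : ℝ) + 1) ≤ K := by exact_mod_cast h
    have h3 : (0 : ℝ) ≤ arrived A true t := by positivity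
    nlinarith

end

section

/-! ### The relative throughput -/

variable {lmin lmax lam p : ℝ} {alg : OnlineAlg} {E : ArrivalPattern → Set ℝ}

/-- The event of local finiteness need not be measurable, so errors are removed on a measurable null
set that contains its complement. -/
theorem IsErrorFunction.exists_isMeasurableErrors (hE : IsErrorFunction lmin lmax lam p E) :
    ∃ E' : ArrivalPattern → Set ℝ, IsMeasurableErrors E' ∧
      ∀ᵐ A ∂(arrivalLaw lam p), E' A = E A := by
  classical
  set G := (toMeasurable (arrivalLaw lam p) {A | ∀ t : ℝ, (E A ∩ Icc 0 t).Finite}ᶜ)ᶜ with hG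
  have hGm : MeasurableSet G := (measurableSet_toMeasurable _ _).compl
  have hGfin : ∀ A ∈ G, ∀ t : ℝ, (E A ∩ Icc 0 t).Finite := fun A hA => by
    by_contra hne
    exact hA (subset_toMeasurable _ _ hne)
  have hGae : ∀ᵐ A ∂(arrivalLaw lam p), A ∈ G := by
    rw [ae_iff]
    have : {A | A ∉ G} = toMeasurable (arrivalLaw lam p)
        {A | ∀ t : ℝ, (E A ∩ Icc 0 t).Finite}ᶜ := by ext A; simp [hG]
    rw [this, measure_toMeasurable]
    exact ae_iff.1 hE.locallyFinite
  refine ⟨fun A => if A ∈ G then E A else ∅, ⟨fun a b ha hab => ?_, fun A t => ?_⟩, ?_⟩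
  · have : {A | ((if A ∈ G then E A else ∅) ∩ Icc a b).Nonempty} =
        G ∩ {A | (E A ∩ Icc a b).Nonempty} := by
      ext A; by_cases hA : A ∈ G <;> simp [hA]
    rw [this]
    exact hGm.inter (history_le b _ (hE.adapted a b ha hab))
  · by_cases hA : A ∈ G
    · simpa [hA] using hGfin A hA t
    · simp [hA]
  · filter_upwards [hGae] with A hA
    simp [hA]

theorem le_throughputAt {A : ArrivalPattern} {F : Set ℝ} {t : ℝ} {a : ℝ≥0∞}
    (hpos : algLength lmin lmax alg A F t ≠ 0)
    (h : a * optLength lmin lmax A F t ≤ algLength lmin lmax alg A F t)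
    (hopt : optLength lmin lmax A F t ≠ ∞) :
    a ≤ throughputAt lmin lmax alg A F t := by
  unfold throughputAt
  rw [if_neg (by tauto)]
  exact (ENNReal.le_div_iff_mul_le (Or.inr hpos) (Or.inl hopt)).2 h

/-- Its role is to make `L_Alg`, and thereby `L_OPT`, finite, so that the quotient of extended reals
behaves well. -/
theorem algLength_le_time (h0 : 0 < lmin) (h1 : lmin < lmax) {A : ArrivalPattern} {F : Set ℝ}
    (hr : IsRegular A F) (t : ℝ) :
    algLength lmin lmax alg A F t ≤ ENNReal.ofReal t := by
  have key : ∀ k, (execution lmin lmax alg A F k).sent lmin lmax ≤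
      (execution lmin lmax alg A F k).time := by
    intro k
    induction k with
    | zero => simp [execution, Config.notify, Config.sent]
    | succ k ih =>
      have hlt := execution_time_lt_succ (alg := alg) h0 h1 hr k
      have hcases := Config.step_cases (lmin := lmin) (lmax := lmax) (alg := alg) hr _
        (execution_time_nonneg (alg := alg) h0 h1 hr k)
      rw [← execution] at hcases
      rcases hcases with hs | ⟨b, hs⟩ | ⟨b, hs⟩
      · have := IdleStep_sent hs
        simp only [Config.sent, this] at ih ⊢; linarith
      · have := InterruptStep_sent hs
        simp only [Config.sent, this] at ih ⊢; linarith
      · rw [DeliverStep_sent hs, DeliverStep_time hs]; linarith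
  exact iSup₂_le fun k hk => ENNReal.ofReal_le_ofReal ((key k).trans hk)

/-- The arrival patterns for which the algorithm has transmitted packets of total length at least
`M` by time `t`. -/
def reaches (lmin lmax : ℝ) (alg : OnlineAlg) (E : ArrivalPattern → Set ℝ) (M t : ℝ) :
    Set ArrivalPattern :=
  {A | ∃ k, (execution lmin lmax alg A (E A) k).time ≤ t ∧
    M ≤ (execution lmin lmax alg A (E A) k).sent lmin lmax}

theorem monotone_reaches (M : ℝ) : Monotone (reaches lmin lmax alg E M) := by
  rintro s t hst A ⟨k, hk, hM⟩
  exact ⟨k, hk.trans hst, hM⟩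

theorem measurableSet_reaches (h0 : 0 < lmin) (h1 : lmin < lmax) (hE : IsMeasurableErrors E)
    (M t : ℝ) : MeasurableSet (reaches lmin lmax alg E M t) := by
  have : reaches lmin lmax alg E M t = ⋃ k, {A | (execution lmin lmax alg A (E A) k).time ≤ t} ∩
      {A | M ≤ (execution lmin lmax alg A (E A) k).sent lmin lmax} := by
    ext A; simp [reaches]
  rw [this]
  refine MeasurableSet.iUnion fun k => ?_
  have hm := isMeasurableConfig_execution (alg := alg) h0 h1 hE k
  refine (measurableSet_le hm.time measurable_const).inter (measurableSet_le measurable_const ?_)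
  exact (((measurable_of_countable (Nat.cast : ℕ → ℝ)).comp hm.sentShort).mul_const _).add
    (((measurable_of_countable (Nat.cast : ℕ → ℝ)).comp hm.sentLong).mul_const _)

/-- The inequality amounts to `a * B ≤ L * (1 - a * κ)`, and `a * κ < 1`. The summand `1` in the
witness makes `M` positive even if `a * B = 0`. -/
theorem exists_mul_add_le {a κ : ℝ≥0∞} (hκ : κ ≠ 0) (hκ' : κ ≠ ∞) (ha : a < κ⁻¹) {B : ℝ≥0∞}
    (hB : B ≠ ∞) : ∃ M : ℝ, 0 < M ∧ ∀ L : ℝ≥0∞, ENNReal.ofReal M ≤ L → L ≠ ∞ →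
      a * (κ * L + B) ≤ L := by
  have ha' : a ≠ ∞ := ha.ne_top
  lift a to NNReal using ha'
  lift κ to NNReal using hκ'
  lift B to NNReal using hB
  have h1 : (a : ℝ) * κ < 1 := by
    rw [← one_div, ENNReal.lt_div_iff_mul_lt (Or.inl hκ) (Or.inl ENNReal.coe_ne_top)] at ha
    exact_mod_cast ha
  refine ⟨a * B / (1 - a * κ) + 1, by
    have : 0 ≤ (a : ℝ) * B / (1 - a * κ) := div_nonneg (by positivity) (by linarith)
    linarith, fun L hL hL' => ?_⟩
  lift L to NNReal using hL'
  rw [← ENNReal.ofReal_coe_nnreal (p := L), ENNReal.ofReal_le_ofReal_iff L.coe_nonneg] at hL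
  have h3 : (a : ℝ) * B ≤ L * (1 - a * κ) := by
    rw [← div_le_iff₀ (by linarith)]; linarith
  have h4 : (a : ℝ) * (κ * L + B) ≤ L := by linarith
  exact_mod_cast h4

/-- For `a' < κ⁻¹`, the ratio is at least `a'` once the algorithm has delivered a large amount `M`,
which on `H K` must happen because `L_OPT → ∞`. These events increase with `t` to almost all of `H
K`, and then `K → ∞`. -/
theorem inv_le_liminf_throughput (h0 : 0 < lmin) (h1 : lmin < lmax) (hlam : 0 < lam)
    (hp0 : 0 < p) (hp1 : p < 1) (hE : IsErrorFunction lmin lmax lam p E) {κ : ℝ≥0∞} (hκ : κ ≠ 0)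
    (hκ' : κ ≠ ∞) {H : ℕ → Set ArrivalPattern} (hH : ∀ K, MeasurableSet (H K)) (hmono : Monotone H)
    (hae : ∀ᵐ A ∂(arrivalLaw lam p), ∃ K, A ∈ H K) {B : ℕ → ℝ≥0∞} (hB : ∀ K, B K ≠ ∞)
    (hbound : ∀ᵐ A ∂(arrivalLaw lam p), IsRegular A (E A) → ∀ K, A ∈ H K → ∀ t, 0 ≤ t →
      optLength lmin lmax A (E A) t ≤ κ * algLength lmin lmax alg A (E A) t + B K) :
    κ⁻¹ ≤ liminf (fun t : ℝ =>
      ∫⁻ A, throughputAt lmin lmax alg A (E A) t ∂(arrivalLaw lam p)) atTop := by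
  have := isProbabilityMeasure_arrivalLaw hlam hp0 hp1
  obtain ⟨E', hE', hEE'⟩ := hE.exists_isMeasurableErrors
  have hreg : ∀ᵐ A ∂(arrivalLaw lam p), IsRegular A (E A) := by
    filter_upwards [hE.locallyFinite, ae_tendsto_arrivalTime hlam hp0 hp1] with A hA hA'
    exact ⟨hA', hA⟩
  refine le_of_forall_lt fun a ha => ?_
  obtain ⟨a', haa', ha'⟩ := exists_between ha
  refine haa'.trans_le ?_
  have hK : ∀ K, a' * arrivalLaw lam p (H K) ≤ liminf (fun t : ℝ =>
      ∫⁻ A, throughputAt lmin lmax alg A (E A) t ∂(arrivalLaw lam p)) atTop := by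
    intro K
    obtain ⟨M, hM, hML⟩ := exists_mul_add_le hκ hκ' ha' (hB K)
    set S : ℝ → Set ArrivalPattern := fun t => H K ∩ reaches lmin lmax alg E' M t with hS
    have hSmono : Monotone S := fun s t hst => inter_subset_inter_right _ (monotone_reaches M hst)
    have hSm : ∀ t, MeasurableSet (S t) := fun t =>
      (hH K).inter (measurableSet_reaches h0 h1 hE' M t)
    have hint : ∀ t, 0 ≤ t → a' * arrivalLaw lam p (S t) ≤
        ∫⁻ A, throughputAt lmin lmax alg A (E A) t ∂(arrivalLaw lam p) := by
      intro t ht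
      -- Measurability of the ratio is not needed: it suffices to bound it below by a constant times
      -- the indicator of a measurable event.
      rw [← lintegral_indicator_const (hSm t)]
      refine lintegral_mono_ae ?_
      filter_upwards [hbound, hreg, hEE'] with A hA hr hEA
      by_cases hAS : A ∈ S t
      · rw [indicator_of_mem hAS]
        obtain ⟨hAH, k, hk, hkM⟩ := hAS
        rw [hEA] at hk hkM
        have hL : ENNReal.ofReal M ≤ algLength lmin lmax alg A (E A) t :=
          (ENNReal.ofReal_le_ofReal hkM).trans (sent_le_algLength hk)
        have hfin : algLength lmin lmax alg A (E A) t ≠ ∞ :=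
          ((algLength_le_time h0 h1 hr t).trans_lt ENNReal.ofReal_lt_top).ne
        have hopt := hA hr K hAH t ht
        refine le_throughputAt ?_ ((mul_le_mul_right hopt a').trans (hML _ hL hfin)) ?_
        · exact ((ENNReal.ofReal_pos.2 hM).trans_le hL).ne'
        · exact (hopt.trans_lt (ENNReal.add_lt_top.2
            ⟨ENNReal.mul_lt_top hκ'.lt_top hfin.lt_top, (hB K).lt_top⟩)).ne
      · rw [indicator_of_notMem hAS]; exact zero_le
    -- If the algorithm never delivered more than `M`, the bound on `H K` would keep `L_OPT`
    -- bounded.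
    have hunion : arrivalLaw lam p (H K) ≤ arrivalLaw lam p (⋃ t, S t) := by
      refine measure_mono_ae ?_
      filter_upwards [hbound, hreg, hEE', hE.nontrivial] with A hA hr hEA hopt hAH
      have hfinite : κ * ENNReal.ofReal M + B K < ∞ := ENNReal.add_lt_top.2
        ⟨ENNReal.mul_lt_top hκ'.lt_top ENNReal.ofReal_lt_top, (hB K).lt_top⟩
      obtain ⟨t, ht, ht0⟩ := ((hopt.eventually_const_lt hfinite).and (eventually_ge_atTop 0)).exists
      have hlt : ENNReal.ofReal M < algLength lmin lmax alg A (E A) t := by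
        by_contra! hle
        refine absurd ((hA hr K hAH t ht0).trans ?_) (not_le.2 ht)
        gcongr
      obtain ⟨k, hk⟩ := lt_iSup_iff.1 hlt
      obtain ⟨hkt, hk⟩ := lt_iSup_iff.1 hk
      refine mem_iUnion.2 ⟨t, hAH, k, ?_, ?_⟩
      · rw [hEA]; exact hkt
      · rw [hEA]; exact ((ENNReal.ofReal_lt_ofReal_iff_of_nonneg hM.le).1 hk).le
    have hlim : Tendsto (fun t => a' * arrivalLaw lam p (S t)) atTop
        (𝓝 (a' * arrivalLaw lam p (⋃ t, S t))) :=
      ENNReal.Tendsto.const_mul (tendsto_measure_iUnion_atTop hSmono) (Or.inr ha'.ne_top)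
    calc a' * arrivalLaw lam p (H K) ≤ a' * arrivalLaw lam p (⋃ t, S t) := by gcongr
      _ = liminf (fun t => a' * arrivalLaw lam p (S t)) atTop := hlim.liminf_eq.symm
      _ ≤ _ := liminf_le_liminf ((eventually_ge_atTop 0).mono hint)
  have hHuniv : arrivalLaw lam p (⋃ K, H K) = 1 := by
    rw [← measure_univ (μ := arrivalLaw lam p)]
    refine measure_congr ?_
    filter_upwards [hae] with A hA
    exact propext ⟨fun _ => trivial, fun _ => mem_iUnion.2 hA⟩
  have hlim : Tendsto (fun K => a' * arrivalLaw lam p (H K)) atTop (𝓝 (a' * 1)) := by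
    rw [← hHuniv]
    exact ENNReal.Tendsto.const_mul (tendsto_measure_iUnion_atTop hmono) (Or.inr ha'.ne_top)
  rw [mul_one] at hlim
  exact le_of_tendsto' hlim hK

/-! ### The throughput of the two algorithms -/

theorem gammaBar_pos (h0 : 0 < lmin) (h1 : lmin < lmax) : 0 < gammaBar lmin lmax := by
  rw [gammaBar, Nat.floor_pos, rho, one_le_div h0]
  exact h1.le

theorem gammaBar_mul_le (h0 : 0 < lmin) (h1 : lmin < lmax) :
    gammaBar lmin lmax * lmin ≤ lmax := by
  rw [← le_div_iff₀ h0]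
  exact Nat.floor_le (div_nonneg (h0.trans h1).le h0.le)

theorem le_relativeThroughput_algSLPreamble (h0 : 0 < lmin) (h1 : lmin < lmax) (hlam : 0 < lam)
    (hp0 : 0 < p) (hp1 : p < 1) :
    ENNReal.ofReal (gammaBar lmin lmax / (rho lmin lmax + gammaBar lmin lmax)) ≤
      relativeThroughput lmin lmax lam p (algSLPreamble (gammaBar lmin lmax)) := by
  refine le_iInf₂ fun E hE => ?_
  have hmax := h0.trans h1
  have hg0 := gammaBar_pos h0 h1
  have hg := gammaBar_mul_le h0 h1
  have hgr : (0 : ℝ) < gammaBar lmin lmax := by exact_mod_cast hg0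
  have hpos : 0 < 1 + lmax / (gammaBar lmin lmax * lmin) := by positivity
  have heq : (gammaBar lmin lmax / (rho lmin lmax + gammaBar lmin lmax) : ℝ) =
      (1 + lmax / (gammaBar lmin lmax * lmin))⁻¹ := by
    rw [rho]; field_simp; ring
  rw [heq, ENNReal.ofReal_inv_of_pos hpos]
  refine inv_le_liminf_throughput h0 h1 hlam hp0 hp1 hE (ENNReal.ofReal_pos.2 hpos).ne'
    ENNReal.ofReal_ne_top (H := fun _ => univ) (fun _ => .univ) monotone_const (by simp)
    (B := fun _ => ENNReal.ofReal (gammaBar lmin lmax * lmin + 2 * lmax + 2 * lmax))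
    (fun _ => ENNReal.ofReal_ne_top) ?_
  exact .of_forall fun A hr K _ t ht => optLength_le_algSLPreamble h0 h1 hr hg0 hg ht

/-- It is enough to reach every `c` below the minimum. The gap to `lam * p * lmin` is the slack that
the strong laws need. -/
theorem le_relativeThroughput_algSL (h0 : 0 < lmin) (h1 : lmin < lmax) (hlam : 0 < lam)
    (hp0 : 0 < p) (hp1 : p < 1) :
    ENNReal.ofReal (min (lam * p * lmin) (gammaBar lmin lmax / rho lmin lmax)) ≤
      relativeThroughput lmin lmax lam p algSL := by
  refine le_iInf₂ fun E hE => le_of_forall_lt fun a ha => ?_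
  have hmax := h0.trans h1
  have hg := gammaBar_mul_le h0 h1
  obtain ⟨c', hac, hc'⟩ := exists_between ha
  set c := c'.toReal with hcdef
  have hc'eq : c' = ENNReal.ofReal c := (ENNReal.ofReal_toReal hc'.ne_top).symm
  refine hac.trans_le ?_
  have hc : 0 < c := ENNReal.toReal_pos (pos_of_gt hac).ne' hc'.ne_top
  rw [hc'eq, ENNReal.ofReal_lt_ofReal_iff_of_nonneg hc.le, lt_min_iff] at hc'
  obtain ⟨hcp, hcg⟩ := hc'
  have hcg' : c * lmax ≤ gammaBar lmin lmax * lmin := by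
    rw [rho, div_div_eq_mul_div, lt_div_iff₀ hmax] at hcg; exact hcg.le
  -- The square root divides the slack equally between arrival rate and fraction of short packets:
  -- with `α = 1 / (lam * s)` and `β = p * s`, the slope `β / α * lmin` is exactly `c`.
  set s := √(c / (lam * p * lmin)) with hs
  have hden : 0 < lam * p * lmin := by positivity
  have hs0 : 0 < s := Real.sqrt_pos.2 (by positivity)
  have hss : s * s = c / (lam * p * lmin) := Real.mul_self_sqrt (by positivity)
  have hs1 : s < 1 := by
    rw [hs, Real.sqrt_lt' one_pos, one_pow, div_lt_one hden]; exact hcp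
  have hα : 1 / lam < 1 / (lam * s) := by
    apply one_div_lt_one_div_of_lt (by positivity)
    nlinarith
  have hβ : p * s < p := by nlinarith
  have hα0 : 0 < 1 / (lam * s) := by positivity
  have hβ0 : 0 < p * s := by positivity
  have hslope : p * s / (1 / (lam * s)) * lmin = c := by
    have : p * s / (1 / (lam * s)) * lmin = s * s * (lam * p * lmin) := by field_simp
    rw [this, hss]; field_simp
  have hpos : 0 < 1 / c := by positivity
  rw [hc'eq, ← inv_inv c, ← one_div c, ENNReal.ofReal_inv_of_pos hpos]
  refine inv_le_liminf_throughput h0 h1 hlam hp0 hp1 hE (ENNReal.ofReal_pos.2 hpos).ne'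
    ENNReal.ofReal_ne_top (measurableSet_typicalArrivals _ _) (monotone_typicalArrivals _ _)
    (ae_mem_typicalArrivals hlam hp0 hp1 hα hβ)
    (B := fun K => ENNReal.ofReal (p * s * (K + 1) * lmin / c + 2 * lmax))
    (fun _ => ENNReal.ofReal_ne_top) ?_
  filter_upwards [ae_interarrival_nonneg hlam hp0 hp1] with A hnn hr K hK t ht
  refine optLength_le_algSL h0 h1 hr hg hc hcg' (by positivity) (fun u hu => ?_) ht
  have := mul_le_mul_of_nonneg_right
    (le_arrived_of_mem_typicalArrivals hnn hr.arrivals hα0 hβ0 hK hu) h0.le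
  rw [sub_mul, mul_right_comm, hslope] at this
  exact this

end

end PacketScheduling

theorem mainTheorem3 (lmin lmax lam p : ℝ) (hlmin : 0 < lmin) (hlen : lmin < lmax)
    (hlam : 0 < lam) (hp0 : 0 < p) (hp1 : p < 1) :
    (lam * p * lmin ≤
        (PacketScheduling.gammaBar lmin lmax : ℝ) / (2 * PacketScheduling.rho lmin lmax) →
      ENNReal.ofReal ((PacketScheduling.gammaBar lmin lmax : ℝ) /
          (PacketScheduling.rho lmin lmax + PacketScheduling.gammaBar lmin lmax)) ≤
        PacketScheduling.relativeThroughput lmin lmax lam p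
          (PacketScheduling.algCSLPreamble lmin lmax lam p)) ∧
    ((PacketScheduling.gammaBar lmin lmax : ℝ) / (2 * PacketScheduling.rho lmin lmax) <
        lam * p * lmin →
      ENNReal.ofReal (min (lam * p * lmin)
          ((PacketScheduling.gammaBar lmin lmax : ℝ) / PacketScheduling.rho lmin lmax)) ≤
        PacketScheduling.relativeThroughput lmin lmax lam p
          (PacketScheduling.algCSLPreamble lmin lmax lam p)) := by
  refine ⟨fun h => ?_, fun h => ?_⟩
  · rw [PacketScheduling.algCSLPreamble, if_neg (not_lt.2 h)]
    exact PacketScheduling.le_relativeThroughput_algSLPreamble hlmin hlen hlam hp0 hp1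
  · rw [PacketScheduling.algCSLPreamble, if_pos h]
    exact PacketScheduling.le_relativeThroughput_algSL hlmin hlen hlam hp0 hp1
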